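/- All operads are unital nonsymmetric operads in $\mathbb{Z}$-graded abelian groups, with homological degrees and Koszul signs; $x\circ_i y$ denotes partial composition. In a dg operad the differential $d$ has degree $-1$, satisfies $d^2=0$, and is a derivation: $d(x\circ_i y)=dx\circ_i y+(-1)^{|x|}x\circ_i dy$. Let $[\kappa]$ be the operad freely generated by one operation $\kappa$ of arity $0$ and degree $-1$. For an operad $P$, the coproduct $P\vee[\kappa]$ carries a weight grading, given by the number of occurrences of $\kappa$ in an expression. Let $\operatorname{Curv}$ be the following category. Its objects are quadruples $(Q,d,\kappa,Q_0)$, where $(Q,d)$ is a dg operad, $Q_0$ is a suboperad of the underlying graded operad $Q$ (not necessarily closed under $d$), and $\kappa\in Q\setminus Q_0$ is an operation of arity $0$ and degree $-1$, such that 1. the natural morphism $Q_0\vee[\kappa]\to Q$ is an isomorphism of graded operads; 2. with respect to the resulting weight grading $Q=\bigoplus_{j\ge 0}Q_j$, the differential is $d=d_0+d_1$ with $d_0(Q_j)\subset Q_j$ and $d_1(Q_j)\subset Q_{j+1}$ for all $j$; 3. $d_1\kappa=0$. A morphism $(Q,d,\kappa,Q_0)\to(Q',d',\kappa',Q_0')$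 is a morphism of dg operads $f:(Q,d)\to(Q',d')$ with $f(\kappa)=\kappa'$ and $f(Q_0)\subset Q_0'$. Let $\mathrm{cA}_\infty$ be the (shifted) curved $A_\infty$ operad: the free operad on operations $\mu_n$, $n\ge 0$, of arity $n$ and degree $-1$, with the differential determined by $$d\mu_n=-\sum_{\substack{p+q+r=n\\ p,q,r\ge 0}}\mu_{p+1+r}\circ_{p+1}\mu_q .$$ Let $\langle\mu_i\rangle_{i>0}\subset\mathrm{cA}_\infty$ be the suboperad generated by the $\mu_i$ with $i>0$. **Theorem.** The quadruple $(\mathrm{cA}_\infty,d,\mu_0,\langle\mu_i\rangle_{i>0})$ is an object of $\operatorname{Curv}$, and it is the initial object of $\operatorname{Curv}$. -/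

import Mathlib

open CategoryTheory

universe u

namespace CurvedOperad

/-- The Koszul sign `(-1)^e`, as an integer. -/
def ksign (e : ℤ) : ℤ := (e.negOnePow : ℤ)

theorem ksign_add (e f : ℤ) : ksign (e + f) = ksign e * ksign f := by
  simp [ksign, Int.negOnePow_add]

theorem ksign_mul_self (e : ℤ) : ksign e * ksign e = 1 := by
  unfold ksign
  rw [← Units.val_mul, Int.units_mul_self, Units.val_one]

theorem ksign_neg_one : ksign (-1) = -1 := by
  simp [ksign, Int.negOnePow_neg]

/-- A (unital) nonsymmetric operad in `ℤ`-graded abelian groups, presented by partial compositions.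
`obj n a` is the group of operations of arity `n` and homological degree `a`.
`comp i x y` is the partial composition `x ∘_{i+1} y` (inputs are numbered from `0`); the arity `k`
and degree `c` of the composite are tied to those of `x` and `y` by the equations
`m + n = k + 1` and `a + b = c`. -/
structure GrOperad where
  obj : ℕ → ℤ → Type u
  [grp : ∀ n a, AddCommGroup (obj n a)]
  one : obj 1 0
  comp : ∀ {m n k : ℕ} {a b c : ℤ} (i : ℕ), i < m → m + n = k + 1 → a + b = c →
    (obj m a →+ obj n b →+ obj k c)
  one_comp : ∀ {n : ℕ} {b : ℤ} (y : obj n b),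
    comp 0 Nat.one_pos (Nat.add_comm 1 n) (zero_add b) one y = y
  comp_one : ∀ {m : ℕ} {a : ℤ} (i : ℕ) (hi : i < m) (x : obj m a),
    comp i hi rfl (add_zero a) x one = x
  /-- Sequential composition: `(x ∘_i y) ∘_{i+j} z = x ∘_i (y ∘_j z)`. -/
  comp_assoc : ∀ {m n p k l r : ℕ} {a b c e f g : ℤ} (i j : ℕ) (hi : i < m) (hj : j < n)
    (hij : i + j < k) (hk : m + n = k + 1) (hr : k + p = r + 1)
    (hl : n + p = l + 1) (hr' : m + l = r + 1)
    (he : a + b = e) (hg : e + c = g) (hf : b + c = f) (hg' : a + f = g)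
    (x : obj m a) (y : obj n b) (z : obj p c),
    comp (i + j) hij hr hg (comp i hi hk he x y) z = comp i hi hr' hg' x (comp j hj hl hf y z)
  /-- Parallel composition: for inputs `i < j` of `x`,
  `(x ∘_i y) ∘_{j + n - 1} z = (-1)^{|y||z|} (x ∘_j z) ∘_i y`. -/
  comp_parallel : ∀ {m n p k l r : ℕ} {a b c e f g : ℤ} (i j j' : ℕ) (_ : i < j)
    (hi : i < m) (hj : j < m) (_ : j + n = j' + 1) (hjk : j' < k) (hil : i < l)
    (hk : m + n = k + 1) (hr : k + p = r + 1) (hl : m + p = l + 1) (hr' : l + n = r + 1)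
    (he : a + b = e) (hg : e + c = g) (hf : a + c = f) (hg' : f + b = g)
    (x : obj m a) (y : obj n b) (z : obj p c),
    comp j' hjk hr hg (comp i hi hk he x y) z =
      ksign (b * c) • comp i hil hr' hg' (comp j hj hl hf x z) y

attribute [instance] GrOperad.grp

/-- Morphisms of graded operads. -/
@[ext]
structure GrOperad.Hom (P Q : GrOperad.{u}) where
  map : ∀ {n : ℕ} {a : ℤ}, P.obj n a →+ Q.obj n a
  map_one : map P.one = Q.one
  map_comp : ∀ {m n k : ℕ} {a b c : ℤ} (i : ℕ) (hi : i < m) (hk : m + n = k + 1) (hc : a + b = c)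
    (x : P.obj m a) (y : P.obj n b),
    map (P.comp i hi hk hc x y) = Q.comp i hi hk hc (map x) (map y)

instance : Category GrOperad.{u} where
  Hom := GrOperad.Hom
  id P :=
    { map := AddMonoidHom.id _
      map_one := rfl
      map_comp := fun _ _ _ _ _ _ => rfl }
  comp f g :=
    { map := g.map.comp f.map
      map_one := by simp [f.map_one, g.map_one]
      map_comp := by intros; simp [f.map_comp, g.map_comp] }

/-- Sub-operads of a graded operad (closed under the group structure, the identity operation and
partial composition, spanned by homogeneous elements). -/
structure SubOperad (Q : GrOperad.{u}) where
  carrier : ∀ (n : ℕ) (a : ℤ), AddSubgroup (Q.obj n a)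
  one_mem : Q.one ∈ carrier 1 0
  comp_mem : ∀ {m n k : ℕ} {a b c : ℤ} (i : ℕ) (hi : i < m) (hk : m + n = k + 1) (hc : a + b = c)
    {x : Q.obj m a} {y : Q.obj n b}, x ∈ carrier m a → y ∈ carrier n b →
    Q.comp i hi hk hc x y ∈ carrier k c

/-- A sub-operad, as an operad. -/
def SubOperad.toOperad {Q : GrOperad.{u}} (S : SubOperad Q) : GrOperad.{u} where
  obj n a := S.carrier n a
  one := ⟨Q.one, S.one_mem⟩
  comp i hi hk hc := AddMonoidHom.mk' (fun x => AddMonoidHom.mk'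
      (fun y => ⟨Q.comp i hi hk hc x y, S.comp_mem i hi hk hc x.2 y.2⟩)
      (by intros; ext; simp)) (by intros; ext; simp)
  one_comp y := Subtype.ext (Q.one_comp y.1)
  comp_one i hi x := Subtype.ext (Q.comp_one i hi x.1)
  comp_assoc i j hi hj hij hk hr hl hr' he hg hf hg' x y z :=
    Subtype.ext (Q.comp_assoc i j hi hj hij hk hr hl hr' he hg hf hg' x.1 y.1 z.1)
  comp_parallel i j j' hlt hi hj hj' hjk hil hk hr hl hr' he hg hf hg' x y z :=
    Subtype.ext (Q.comp_parallel i j j' hlt hi hj hj' hjk hil hk hr hl hr' he hg hf hg' x.1 y.1 z.1)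

/-- The inclusion of a sub-operad. -/
def SubOperad.incl {Q : GrOperad.{u}} (S : SubOperad Q) : S.toOperad ⟶ Q :=
  GrOperad.Hom.mk (P := S.toOperad) (Q := Q) (fun {n a} => (S.carrier n a).subtype) rfl
    (fun _ _ _ _ _ _ => rfl)

/-- The sub-operad generated by a set of homogeneous operations: the intersection of all the
sub-operads containing it. -/
def SubOperad.closure {Q : GrOperad.{u}} (s : ∀ (n : ℕ) (a : ℤ), Set (Q.obj n a)) :
    SubOperad Q where
  carrier n a :=
    ⨅ S : {S : SubOperad Q // ∀ n a, s n a ⊆ S.carrier n a}, S.1.carrier n a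
  one_mem := by
    simp only [AddSubgroup.mem_iInf]
    exact fun S => S.1.one_mem
  comp_mem := by
    intro m n k a b c i hi hk hc x y hx hy
    simp only [AddSubgroup.mem_iInf] at hx hy ⊢
    exact fun S => S.1.comp_mem i hi hk hc (hx S) (hy S)

/-! ### Free operads -/

/-- Formal operadic expressions in a family `X` of generators with arities and degrees. -/
inductive Pre (X : ℕ → ℤ → Type u) : ℕ → ℤ → Type u
  | gen {n : ℕ} {a : ℤ} (x : X n a) : Pre X n a
  | one : Pre X 1 0
  | comp {m n k : ℕ} {a b c : ℤ} (i : ℕ) (hi : i < m) (hk : m + n = k + 1) (hc : a + b = c)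
      (x : Pre X m a) (y : Pre X n b) : Pre X k c
  | zero {n : ℕ} {a : ℤ} : Pre X n a
  | add {n : ℕ} {a : ℤ} (x y : Pre X n a) : Pre X n a
  | neg {n : ℕ} {a : ℤ} (x : Pre X n a) : Pre X n a

/-- Formal multiplication by `(-1)^e`. -/
def Pre.sgn {X : ℕ → ℤ → Type u} {n : ℕ} {a : ℤ} (e : ℤ) (x : Pre X n a) : Pre X n a :=
  if Even e then x else x.neg

/-- The congruence generated by the axioms of a graded operad. -/
inductive Rel {X : ℕ → ℤ → Type u} : ∀ {n : ℕ} {a : ℤ}, Pre X n a → Pre X n a → Prop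
  | refl {n a} (x : Pre X n a) : Rel x x
  | symm {n a} {x y : Pre X n a} : Rel x y → Rel y x
  | trans {n a} {x y z : Pre X n a} : Rel x y → Rel y z → Rel x z
  | comp_congr {m n k a b c} (i : ℕ) (hi : i < m) (hk : m + n = k + 1) (hc : a + b = c)
      {x x' : Pre X m a} {y y' : Pre X n b} : Rel x x' → Rel y y' →
      Rel (Pre.comp i hi hk hc x y) (Pre.comp i hi hk hc x' y')
  | add_congr {n a} {x x' y y' : Pre X n a} : Rel x x' → Rel y y' → Rel (x.add y) (x'.add y')
  | neg_congr {n a} {x x' : Pre X n a} : Rel x x' → Rel x.neg x'.neg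
  | add_assoc {n a} (x y z : Pre X n a) : Rel ((x.add y).add z) (x.add (y.add z))
  | add_comm {n a} (x y : Pre X n a) : Rel (x.add y) (y.add x)
  | zero_add {n a} (x : Pre X n a) : Rel (Pre.zero.add x) x
  | neg_add {n a} (x : Pre X n a) : Rel (x.neg.add x) Pre.zero
  | add_comp {m n k a b c} (i : ℕ) (hi : i < m) (hk : m + n = k + 1) (hc : a + b = c)
      (x x' : Pre X m a) (y : Pre X n b) :
      Rel (Pre.comp i hi hk hc (x.add x') y)
        ((Pre.comp i hi hk hc x y).add (Pre.comp i hi hk hc x' y))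
  | comp_add {m n k a b c} (i : ℕ) (hi : i < m) (hk : m + n = k + 1) (hc : a + b = c)
      (x : Pre X m a) (y y' : Pre X n b) :
      Rel (Pre.comp i hi hk hc x (y.add y'))
        ((Pre.comp i hi hk hc x y).add (Pre.comp i hi hk hc x y'))
  | one_comp {n b} (y : Pre X n b) :
      Rel (Pre.comp 0 Nat.one_pos (Nat.add_comm 1 n) (_root_.zero_add b) Pre.one y) y
  | comp_one {m a} (i : ℕ) (hi : i < m) (x : Pre X m a) :
      Rel (Pre.comp i hi rfl (add_zero a) x Pre.one) x
  | comp_assoc {m n p k l r : ℕ} {a b c e f g : ℤ} (i j : ℕ) (hi : i < m) (hj : j < n)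
      (hij : i + j < k) (hk : m + n = k + 1) (hr : k + p = r + 1)
      (hl : n + p = l + 1) (hr' : m + l = r + 1)
      (he : a + b = e) (hg : e + c = g) (hf : b + c = f) (hg' : a + f = g)
      (x : Pre X m a) (y : Pre X n b) (z : Pre X p c) :
      Rel (Pre.comp (i + j) hij hr hg (Pre.comp i hi hk he x y) z)
        (Pre.comp i hi hr' hg' x (Pre.comp j hj hl hf y z))
  | comp_parallel {m n p k l r : ℕ} {a b c e f g : ℤ} (i j j' : ℕ) (hlt : i < j)
      (hi : i < m) (hj : j < m) (hj' : j + n = j' + 1) (hjk : j' < k) (hil : i < l)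
      (hk : m + n = k + 1) (hr : k + p = r + 1) (hl : m + p = l + 1) (hr' : l + n = r + 1)
      (he : a + b = e) (hg : e + c = g) (hf : a + c = f) (hg' : f + b = g)
      (x : Pre X m a) (y : Pre X n b) (z : Pre X p c) :
      Rel (Pre.comp j' hjk hr hg (Pre.comp i hi hk he x y) z)
        (Pre.sgn (b * c) (Pre.comp i hil hr' hg' (Pre.comp j hj hl hf x z) y))

/-- The setoid of formal expressions up to the operad axioms. -/
def preSetoid (X : ℕ → ℤ → Type u) (n : ℕ) (a : ℤ) : Setoid (Pre X n a) :=
  ⟨Rel, ⟨Rel.refl, Rel.symm, Rel.trans⟩⟩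

/-- Operations of the free operad on `X`. -/
def FreeObj (X : ℕ → ℤ → Type u) (n : ℕ) (a : ℤ) : Type u := Quotient (preSetoid X n a)

/-- The class of a formal expression. -/
def FreeObj.mk {X : ℕ → ℤ → Type u} {n : ℕ} {a : ℤ} (x : Pre X n a) : FreeObj X n a :=
  Quotient.mk (preSetoid X n a) x

theorem FreeObj.sound {X : ℕ → ℤ → Type u} {n : ℕ} {a : ℤ} {x y : Pre X n a} (h : Rel x y) :
    FreeObj.mk x = FreeObj.mk y := Quotient.sound (s := preSetoid X n a) h

theorem FreeObj.ind {X : ℕ → ℤ → Type u} {n : ℕ} {a : ℤ} {p : FreeObj X n a → Prop}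
    (h : ∀ x, p (FreeObj.mk x)) (x : FreeObj X n a) : p x := Quotient.ind h x

instance (X : ℕ → ℤ → Type u) (n : ℕ) (a : ℤ) : Add (FreeObj X n a) :=
  ⟨Quotient.map₂ Pre.add (fun _ _ h _ _ h' => Rel.add_congr h h')⟩

instance (X : ℕ → ℤ → Type u) (n : ℕ) (a : ℤ) : Zero (FreeObj X n a) :=
  ⟨FreeObj.mk Pre.zero⟩

instance (X : ℕ → ℤ → Type u) (n : ℕ) (a : ℤ) : Neg (FreeObj X n a) :=
  ⟨Quotient.map Pre.neg (fun _ _ h => Rel.neg_congr h)⟩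

instance (X : ℕ → ℤ → Type u) (n : ℕ) (a : ℤ) : AddCommGroup (FreeObj X n a) where
  add_assoc x y z := by
    induction x using FreeObj.ind; induction y using FreeObj.ind; induction z using FreeObj.ind
    exact FreeObj.sound (Rel.add_assoc _ _ _)
  add_comm x y := by
    induction x using FreeObj.ind; induction y using FreeObj.ind
    exact FreeObj.sound (Rel.add_comm _ _)
  zero_add x := by
    induction x using FreeObj.ind
    exact FreeObj.sound (Rel.zero_add _)
  add_zero x := by
    induction x using FreeObj.ind
    exact FreeObj.sound ((Rel.add_comm _ _).trans (Rel.zero_add _))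
  neg_add_cancel x := by
    induction x using FreeObj.ind
    exact FreeObj.sound (Rel.neg_add _)
  nsmul := nsmulRec
  zsmul := zsmulRec

theorem FreeObj.mk_add {X : ℕ → ℤ → Type u} {n : ℕ} {a : ℤ} (x y : Pre X n a) :
    FreeObj.mk (x.add y) = FreeObj.mk x + FreeObj.mk y := rfl

theorem FreeObj.mk_neg {X : ℕ → ℤ → Type u} {n : ℕ} {a : ℤ} (x : Pre X n a) :
    FreeObj.mk x.neg = - FreeObj.mk x := rfl

theorem FreeObj.mk_zero {X : ℕ → ℤ → Type u} {n : ℕ} {a : ℤ} :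
    FreeObj.mk (Pre.zero : Pre X n a) = 0 := rfl

theorem ksign_of_even {e : ℤ} (h : Even e) : ksign e = 1 := by
  simp [ksign, Int.negOnePow_even e h]

theorem ksign_of_not_even {e : ℤ} (h : ¬ Even e) : ksign e = -1 := by
  simp [ksign, Int.negOnePow_odd e (Int.not_even_iff_odd.mp h)]

theorem FreeObj.mk_sgn {X : ℕ → ℤ → Type u} {n : ℕ} {a : ℤ} (e : ℤ) (x : Pre X n a) :
    FreeObj.mk (x.sgn e) = ksign e • FreeObj.mk x := by
  unfold Pre.sgn
  split_ifs with h
  · rw [ksign_of_even h, one_smul]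
  · rw [ksign_of_not_even h, FreeObj.mk_neg, neg_smul, one_smul]

/-- Partial composition in the free operad. -/
def FreeObj.comp {X : ℕ → ℤ → Type u} {m n k : ℕ} {a b c : ℤ} (i : ℕ) (hi : i < m)
    (hk : m + n = k + 1) (hc : a + b = c) :
    FreeObj X m a →+ FreeObj X n b →+ FreeObj X k c :=
  AddMonoidHom.mk' (fun x => AddMonoidHom.mk'
    (fun y => Quotient.map₂ (Pre.comp i hi hk hc)
      (fun _ _ h _ _ h' => Rel.comp_congr i hi hk hc h h') x y)
    (by
      intro y y'
      induction x using FreeObj.ind; induction y using FreeObj.ind; induction y' using FreeObj.ind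
      exact FreeObj.sound (Rel.comp_add _ _ _ _ _ _ _)))
    (by
      intro x x'
      ext y
      induction x using FreeObj.ind; induction y using FreeObj.ind; induction x' using FreeObj.ind
      exact FreeObj.sound (Rel.add_comp _ _ _ _ _ _ _))

theorem FreeObj.mk_comp {X : ℕ → ℤ → Type u} {m n k : ℕ} {a b c : ℤ} (i : ℕ) (hi : i < m)
    (hk : m + n = k + 1) (hc : a + b = c) (x : Pre X m a) (y : Pre X n b) :
    FreeObj.mk (Pre.comp i hi hk hc x y) =
      FreeObj.comp i hi hk hc (FreeObj.mk x) (FreeObj.mk y) := rfl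

theorem FreeObj.comp_assoc {X : ℕ → ℤ → Type u} {m n p k l r : ℕ} {a b c e f g : ℤ} (i j : ℕ)
    (hi : i < m) (hj : j < n)
    (hij : i + j < k) (hk : m + n = k + 1) (hr : k + p = r + 1)
    (hl : n + p = l + 1) (hr' : m + l = r + 1)
    (he : a + b = e) (hg : e + c = g) (hf : b + c = f) (hg' : a + f = g)
    (x : FreeObj X m a) (y : FreeObj X n b) (z : FreeObj X p c) :
    FreeObj.comp (i + j) hij hr hg (FreeObj.comp i hi hk he x y) z =
      FreeObj.comp i hi hr' hg' x (FreeObj.comp j hj hl hf y z) := by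
  induction x using FreeObj.ind; induction y using FreeObj.ind; induction z using FreeObj.ind
  exact FreeObj.sound (Rel.comp_assoc i j hi hj hij hk hr hl hr' he hg hf hg' _ _ _)

theorem FreeObj.comp_parallel {X : ℕ → ℤ → Type u} {m n p k l r : ℕ} {a b c e f g : ℤ}
    (i j j' : ℕ) (hlt : i < j)
    (hi : i < m) (hj : j < m) (hj' : j + n = j' + 1) (hjk : j' < k) (hil : i < l)
    (hk : m + n = k + 1) (hr : k + p = r + 1) (hl : m + p = l + 1) (hr' : l + n = r + 1)
    (he : a + b = e) (hg : e + c = g) (hf : a + c = f) (hg' : f + b = g)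
    (x : FreeObj X m a) (y : FreeObj X n b) (z : FreeObj X p c) :
    FreeObj.comp j' hjk hr hg (FreeObj.comp i hi hk he x y) z =
      ksign (b * c) • FreeObj.comp i hil hr' hg' (FreeObj.comp j hj hl hf x z) y := by
  induction x using FreeObj.ind; induction y using FreeObj.ind; induction z using FreeObj.ind
  refine (FreeObj.sound (Rel.comp_parallel i j j' hlt hi hj hj' hjk hil hk hr hl hr'
    he hg hf hg' _ _ _)).trans ?_
  rw [FreeObj.mk_sgn]
  rfl

/-- The free graded operad on a family `X` of generators with arities and degrees. -/
def FreeOperad (X : ℕ → ℤ → Type u) : GrOperad.{u} where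
  obj := FreeObj X
  one := FreeObj.mk Pre.one
  comp := FreeObj.comp
  one_comp y := by
    induction y using FreeObj.ind
    exact FreeObj.sound (Rel.one_comp _)
  comp_one i hi x := by
    induction x using FreeObj.ind
    exact FreeObj.sound (Rel.comp_one i hi _)
  comp_assoc := FreeObj.comp_assoc
  comp_parallel := FreeObj.comp_parallel

/-- A generator, as an operation of the free operad. -/
def FreeOperad.gen {X : ℕ → ℤ → Type u} {n : ℕ} {a : ℤ} (x : X n a) : (FreeOperad X).obj n a :=
  FreeObj.mk (Pre.gen x)

/-- Evaluation of formal expressions in an operad. -/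
def Pre.eval {X : ℕ → ℤ → Type u} (R : GrOperad.{u}) (φ : ∀ {n : ℕ} {a : ℤ}, X n a → R.obj n a) :
    ∀ {n : ℕ} {a : ℤ}, Pre X n a → R.obj n a
  | _, _, .gen x => φ x
  | _, _, .one => R.one
  | _, _, .comp i hi hk hc x y => R.comp i hi hk hc (x.eval R φ) (y.eval R φ)
  | _, _, .zero => 0
  | _, _, .add x y => x.eval R φ + y.eval R φ
  | _, _, .neg x => - x.eval R φ

theorem Pre.eval_sgn {X : ℕ → ℤ → Type u} (R : GrOperad.{u})
    (φ : ∀ {n : ℕ} {a : ℤ}, X n a → R.obj n a) {n : ℕ} {a : ℤ} (e : ℤ) (x : Pre X n a) :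
    (x.sgn e).eval R φ = ksign e • x.eval R φ := by
  unfold Pre.sgn
  split_ifs with h
  · rw [ksign_of_even h, one_smul]
  · rw [ksign_of_not_even h, Pre.eval, neg_smul, one_smul]

theorem Rel.eval_eq {X : ℕ → ℤ → Type u} (R : GrOperad.{u})
    (φ : ∀ {n : ℕ} {a : ℤ}, X n a → R.obj n a) {n : ℕ} {a : ℤ} {x y : Pre X n a} (h : Rel x y) :
    x.eval R φ = y.eval R φ := by
  induction h with
  | refl => rfl
  | symm _ ih => exact ih.symm
  | trans _ _ ih ih' => exact ih.trans ih'
  | comp_congr _ _ _ _ _ _ ih ih' => simp only [Pre.eval, ih, ih']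
  | add_congr _ _ ih ih' => simp only [Pre.eval, ih, ih']
  | neg_congr _ ih => simp only [Pre.eval, ih]
  | add_assoc => simp only [Pre.eval, _root_.add_assoc]
  | add_comm => simp only [Pre.eval]; exact _root_.add_comm _ _
  | zero_add => simp only [Pre.eval, _root_.zero_add]
  | neg_add => simp only [Pre.eval, neg_add_cancel]
  | add_comp => simp only [Pre.eval, map_add, AddMonoidHom.add_apply]
  | comp_add => simp only [Pre.eval, map_add]
  | one_comp => simp only [Pre.eval]; exact R.one_comp _
  | comp_one => simp only [Pre.eval]; exact R.comp_one _ _ _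
  | comp_assoc => simp only [Pre.eval]; apply R.comp_assoc
  | comp_parallel => rw [Pre.eval_sgn]; simp only [Pre.eval]; apply R.comp_parallel <;> assumption

/-- The morphism out of a free operad with prescribed values on the generators. -/
def FreeOperad.lift {X : ℕ → ℤ → Type u} (R : GrOperad.{u})
    (φ : ∀ {n : ℕ} {a : ℤ}, X n a → R.obj n a) : FreeOperad X ⟶ R :=
  GrOperad.Hom.mk (P := FreeOperad X) (Q := R)
    (fun {n a} => AddMonoidHom.mk' (fun x : FreeObj X n a =>
        Quotient.lift (s := preSetoid X n a) (fun x => x.eval R φ) (fun _ _ h => Rel.eval_eq R φ h) x)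
      (by
        intro x y
        induction x using FreeObj.ind; induction y using FreeObj.ind
        rfl))
    rfl
    (by
      intro m n k a b c i hi hk hc x y
      induction x using FreeObj.ind; induction y using FreeObj.ind
      rfl)

/-! ### Differentials -/

/-- Families of additive maps lowering the homological degree by one and preserving the arity. -/
abbrev GrOperad.LowerMap (Q : GrOperad.{u}) : Type u :=
  ∀ {n : ℕ} {a b : ℤ}, b + 1 = a → (Q.obj n a →+ Q.obj n b)

/-- A nonsymmetric dg operad, with homological conventions: a graded operad with a degree `-1`
derivation of square zero. -/
structure DGOperad extends GrOperad.{u} where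
  d : toGrOperad.LowerMap
  d_comp : ∀ {m n k : ℕ} {a b c a' b' c' : ℤ} (i : ℕ) (hi : i < m) (hk : m + n = k + 1)
    (hc : a + b = c) (ha' : a' + 1 = a) (hb' : b' + 1 = b) (hc' : c' + 1 = c)
    (h₁ : a' + b = c') (h₂ : a + b' = c') (x : obj m a) (y : obj n b),
    d hc' (comp i hi hk hc x y) =
      comp i hi hk h₁ (d ha' x) y + ksign a • comp i hi hk h₂ x (d hb' y)
  d_d : ∀ {n : ℕ} {a b c : ℤ} (hb : b + 1 = a) (hc : c + 1 = b) (x : obj n a), d hc (d hb x) = 0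

/-- Morphisms of dg operads. -/
@[ext]
structure DGOperad.Hom (P Q : DGOperad.{u}) extends
    toGrHom : GrOperad.Hom P.toGrOperad Q.toGrOperad where
  map_d : ∀ {n : ℕ} {a b : ℤ} (h : b + 1 = a) (x : P.obj n a), map (P.d h x) = Q.d h (map x)

section Derivation

variable {X : ℕ → ℤ → Type u}
  (δ : ∀ {n : ℕ} {a : ℤ}, X n a → ∀ b : ℤ, b + 1 = a → FreeObj X n b)

/-- The derivation of the free operad with value `δ` on the generators, on formal expressions. -/
def Pre.deriv : ∀ {n : ℕ} {a : ℤ}, Pre X n a → ∀ b : ℤ, b + 1 = a → FreeObj X n b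
  | _, _, .gen x, b, h => δ x b h
  | _, _, .one, _, _ => 0
  | _, _, .comp (a := a) (b := b) i hi hk hc x y, _, h =>
      FreeObj.comp i hi hk (by omega) (x.deriv (a - 1) (by omega)) (FreeObj.mk y) +
        ksign a • FreeObj.comp i hi hk (by omega) (FreeObj.mk x) (y.deriv (b - 1) (by omega))
  | _, _, .zero, _, _ => 0
  | _, _, .add x y, b, h => x.deriv b h + y.deriv b h
  | _, _, .neg x, b, h => - x.deriv b h

theorem Pre.deriv_sgn {n : ℕ} {a : ℤ} (e : ℤ) (x : Pre X n a) (b : ℤ) (h : b + 1 = a) :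
    (x.sgn e).deriv δ b h = ksign e • x.deriv δ b h := by
  unfold Pre.sgn
  split_ifs with h
  · rw [ksign_of_even h, one_smul]
  · rw [ksign_of_not_even h, Pre.deriv, neg_smul, one_smul]

theorem Rel.deriv_eq {n : ℕ} {a : ℤ} {x y : Pre X n a} (h : Rel x y) :
    ∀ (b : ℤ) (hb : b + 1 = a), x.deriv δ b hb = y.deriv δ b hb := by
  induction h with
  | refl => intros; rfl
  | symm _ ih => intros; exact (ih _ _).symm
  | trans _ _ ih ih' => intros; exact (ih _ _).trans (ih' _ _)
  | comp_congr _ _ _ _ h h' ih ih' =>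
    intros
    simp only [Pre.deriv, ih, ih', FreeObj.sound h, FreeObj.sound h']
  | add_congr _ _ ih ih' => intros; simp only [Pre.deriv, ih, ih']
  | neg_congr _ ih => intros; simp only [Pre.deriv, ih]
  | add_assoc => intros; simp only [Pre.deriv, _root_.add_assoc]
  | add_comm => intros; simp only [Pre.deriv]; exact _root_.add_comm _ _
  | zero_add => intros; simp only [Pre.deriv, _root_.zero_add]
  | neg_add => intros; simp only [Pre.deriv, neg_add_cancel]
  | add_comp =>
    intros
    simp only [Pre.deriv, FreeObj.mk_add, map_add, AddMonoidHom.add_apply, smul_add]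
    abel
  | comp_add =>
    intros
    simp only [Pre.deriv, FreeObj.mk_add, map_add, smul_add]
    abel
  | one_comp y =>
    intro b' hb
    obtain rfl : b' = _ - 1 := eq_sub_of_add_eq hb
    simp only [Pre.deriv, map_zero, AddMonoidHom.zero_apply, _root_.zero_add,
      ksign_of_even Even.zero, one_smul]
    exact (FreeOperad X).one_comp _
  | comp_one i hi x =>
    intro b' hb
    obtain rfl : b' = _ - 1 := eq_sub_of_add_eq hb
    simp only [Pre.deriv, map_zero, smul_zero, add_zero]
    exact (FreeOperad X).comp_one i hi _
  | @comp_assoc m n p k l r a b c e f g i j hi hj hij hk hr hl hr' he hg hf hg' x y z =>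
    intro b' hb
    simp only [Pre.deriv, FreeObj.mk_comp, map_add, AddMonoidHom.add_apply, smul_add, map_zsmul,
      AddMonoidHom.smul_apply, smul_smul]
    rw [FreeObj.comp_assoc (a := a - 1) (f := f) i j hi hj hij hk hr hl hr' (by omega) (by omega)
        hf (by omega),
      FreeObj.comp_assoc (a := a) (b := b - 1) (f := f - 1) i j hi hj hij hk hr hl hr' (by omega)
        (by omega) (by omega) (by omega),
      FreeObj.comp_assoc (c := c - 1) (f := f - 1) i j hi hj hij hk hr hl hr' he (by omega)
        (by omega) (by omega), _root_.add_assoc]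
    have h : ksign e = ksign a * ksign b := by rw [← he, ksign_add]
    rw [h]
  | @comp_parallel m n p k l r a b c e f g i j j' hlt hi hj hj' hjk hil hk hr hl hr'
      he hg hf hg' x y z =>
    intro b' hb
    rw [Pre.deriv_sgn]
    simp only [Pre.deriv, FreeObj.mk_comp, map_add, AddMonoidHom.add_apply, smul_add, map_zsmul,
      AddMonoidHom.smul_apply, smul_smul]
    rw [FreeObj.comp_parallel (a := a - 1) (f := f - 1) i j j' hlt hi hj hj' hjk hil hk hr hl hr'
        (by omega) (by omega) (by omega) (by omega),
      FreeObj.comp_parallel (b := b - 1) (f := f) i j j' hlt hi hj hj' hjk hil hk hr hl hr'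
        (by omega) (by omega) hf (by omega),
      FreeObj.comp_parallel (c := c - 1) (f := f - 1) i j j' hlt hi hj hj' hjk hil hk hr hl hr' he
        (by omega) (by omega) (by omega)]
    simp only [smul_smul]
    have h1 : ksign a * ksign ((b - 1) * c) = ksign (b * c) * ksign f := by
      rw [← ksign_add, ← ksign_add, ← hf]
      have : b * c + (a + c) = a + (b - 1) * c + (c + c) := by ring
      rw [this, ksign_add _ (c + c), ksign_add c c, ksign_mul_self, mul_one]
    have h2 : ksign e * ksign (b * (c - 1)) = ksign (b * c) * ksign a := by
      rw [← ksign_add, ← ksign_add, ← he]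
      have : a + b + b * (c - 1) = b * c + a := by ring
      rw [this]
    rw [h1, h2]
    abel

/-- The derivation of degree `-1` of a free operad with prescribed values on the generators. -/
def FreeObj.deriv {n : ℕ} {a b : ℤ} (h : b + 1 = a) : FreeObj X n a →+ FreeObj X n b :=
  AddMonoidHom.mk' (fun x => Quotient.lift (s := preSetoid X n a) (fun x => x.deriv δ b h)
      (fun _ _ hr => Rel.deriv_eq δ hr b h) x)
    (by
      intro x y
      induction x using FreeObj.ind; induction y using FreeObj.ind
      rfl)

theorem FreeObj.deriv_mk {n : ℕ} {a b : ℤ} (h : b + 1 = a) (x : Pre X n a) :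
    FreeObj.deriv δ h (FreeObj.mk x) = x.deriv δ b h := rfl

theorem FreeObj.deriv_comp {m n k : ℕ} {a b c a' b' c' : ℤ} (i : ℕ) (hi : i < m)
    (hk : m + n = k + 1) (hc : a + b = c) (ha' : a' + 1 = a) (hb' : b' + 1 = b) (hc' : c' + 1 = c)
    (h₁ : a' + b = c') (h₂ : a + b' = c') (x : FreeObj X m a) (y : FreeObj X n b) :
    FreeObj.deriv δ hc' (FreeObj.comp i hi hk hc x y) =
      FreeObj.comp i hi hk h₁ (FreeObj.deriv δ ha' x) y +
        ksign a • FreeObj.comp i hi hk h₂ x (FreeObj.deriv δ hb' y) := by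
  obtain rfl : a' = a - 1 := eq_sub_of_add_eq ha'
  obtain rfl : b' = b - 1 := eq_sub_of_add_eq hb'
  induction x using FreeObj.ind; induction y using FreeObj.ind
  rfl

theorem ksign_pred {a a' : ℤ} (h : a' + 1 = a) : ksign a' = - ksign a := by
  rw [← h, ksign_add]
  simp [ksign]

/-- A derivation of a free operad squares to zero as soon as it does so on generators. -/
theorem FreeObj.deriv_deriv
    (hδ : ∀ {n : ℕ} {a : ℤ} (x : X n a) (b c : ℤ) (hb : b + 1 = a) (hc : c + 1 = b),
      FreeObj.deriv δ hc (δ x b hb) = 0)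
    {n : ℕ} {a b c : ℤ} (hb : b + 1 = a) (hc : c + 1 = b) (x : FreeObj X n a) :
    FreeObj.deriv δ hc (FreeObj.deriv δ hb x) = 0 := by
  induction x using FreeObj.ind with
  | h x =>
    induction x generalizing b c with
    | gen x => exact hδ x b c hb hc
    | one => simp only [FreeObj.deriv_mk, Pre.deriv, map_zero]
    | @comp m n k a₁ a₂ a₃ i hi hk h x y ihx ihy =>
      rw [FreeObj.mk_comp,
        FreeObj.deriv_comp δ i hi hk h (a' := a₁ - 1) (b' := a₂ - 1) (by omega) (by omega) hb
          (by omega) (by omega),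
        map_add, map_zsmul,
        FreeObj.deriv_comp δ i hi hk (c := b) (a' := a₁ - 2) (b' := a₂ - 1) (by omega) (by omega)
          (by omega) hc (by omega) (by omega),
        FreeObj.deriv_comp δ i hi hk (c := b) (a' := a₁ - 1) (b' := a₂ - 2) (by omega) (by omega)
          (by omega) hc (by omega) (by omega), ihx, ihy,
        ksign_pred (a := a₁) (a' := a₁ - 1) (by omega)]
      simp
    | zero => simp only [FreeObj.mk_zero, map_zero]
    | add x y ihx ihy => simp only [FreeObj.mk_add, map_add, ihx, ihy, add_zero]
    | neg x ihx => simp only [FreeObj.mk_neg, map_neg, ihx, neg_zero]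

end Derivation

/-! ### The curved A-infinity operad -/

/-- Generators `μ_n`, `n ≥ 0`, of arity `n` and degree `-1`. -/
inductive CAGen : ℕ → ℤ → Type u
  | mu (n : ℕ) : CAGen n (-1)

/-- The operation `μ_n` of the free operad on the generators. -/
def mu (n : ℕ) : FreeObj CAGen.{u} n (-1) := FreeObj.mk (Pre.gen (CAGen.mu n))

/-- `- ∑_{p+q+r=n} μ_{p+1+r} ∘_{p+1} μ_q`. The sum runs over `0 ≤ q ≤ n` and
`0 ≤ p ≤ n - q`; then `r = n - q - p`, so that `p + 1 + r = n + 1 - q`. -/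
def muDiff (n : ℕ) (b : ℤ) (hb : b + 1 = -1) : FreeObj CAGen.{u} n b :=
  - ∑ q : Fin (n + 1), ∑ p : Fin (n + 1 - q),
      FreeObj.comp (p : ℕ) p.2 (by omega) (by omega) (mu (n + 1 - q)) (mu q)

/-- The values of the differential on the generators. -/
def caGenDiff : ∀ {n : ℕ} {a : ℤ}, CAGen.{u} n a → ∀ b : ℤ, b + 1 = a → FreeObj CAGen.{u} n b
  | _, _, .mu n, b, hb => muDiff n b hb

/-- Partial composition extended by zero to all indices; only used to manipulate sums. -/
def tcomp {X : ℕ → ℤ → Type u} {m n : ℕ} {a b : ℤ} (k : ℕ) (c : ℤ) (i : ℕ)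
    (x : FreeObj X m a) (y : FreeObj X n b) : FreeObj X k c :=
  if h : i < m ∧ m + n = k + 1 ∧ a + b = c then FreeObj.comp i h.1 h.2.1 h.2.2 x y else 0

theorem tcomp_eq {X : ℕ → ℤ → Type u} {m n k : ℕ} {a b c : ℤ} (i : ℕ) (hi : i < m)
    (hk : m + n = k + 1) (hc : a + b = c) (x : FreeObj X m a) (y : FreeObj X n b) :
    FreeObj.comp i hi hk hc x y = tcomp k c i x y := by
  rw [tcomp, dif_pos ⟨hi, hk, hc⟩]

theorem sum_tcomp {ι : Type*} {X : ℕ → ℤ → Type u} {m n : ℕ} {a b : ℤ} (k : ℕ) (c : ℤ) (i : ℕ)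
    (s : Finset ι) (x : ι → FreeObj X m a) (y : FreeObj X n b) :
    tcomp k c i (∑ j ∈ s, x j) y = ∑ j ∈ s, tcomp k c i (x j) y := by
  unfold tcomp
  split_ifs
  · rw [map_sum, AddMonoidHom.finsetSum_apply]
  · rw [Finset.sum_const_zero]

theorem tcomp_sum {ι : Type*} {X : ℕ → ℤ → Type u} {m n : ℕ} {a b : ℤ} (k : ℕ) (c : ℤ) (i : ℕ)
    (s : Finset ι) (x : FreeObj X m a) (y : ι → FreeObj X n b) :
    tcomp k c i x (∑ j ∈ s, y j) = ∑ j ∈ s, tcomp k c i x (y j) := by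
  unfold tcomp
  split_ifs
  · rw [map_sum]
  · rw [Finset.sum_const_zero]

theorem muDiff_eq (n : ℕ) (b : ℤ) (hb : b + 1 = -1) :
    muDiff.{u} n b hb = - ∑ q ∈ Finset.range (n + 1), ∑ p ∈ Finset.range (n + 1 - q),
      tcomp n b p (mu (n + 1 - q)) (mu q) := by
  unfold muDiff
  simp only [tcomp_eq]
  rw [Finset.sum_range]
  congr 1
  refine Finset.sum_congr rfl fun q _ => ?_
  rw [Finset.sum_range]

theorem deriv_mu (n : ℕ) (b : ℤ) (hb : b + 1 = -1) :
    FreeObj.deriv caGenDiff.{u} hb (mu n) = muDiff n b hb := rfl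

/-- The sum of all the composites `(μ_a ∘_i μ_b) ∘_j μ_c` of arity `n` equals the sum of all the
composites `μ_a ∘_i (μ_b ∘_j μ_c)`: the parallel ones cancel in pairs. -/
theorem mu_sum (n : ℕ) :
    ∑ q ∈ Finset.range (n + 1), ∑ p ∈ Finset.range (n + 1 - q),
      ∑ q' ∈ Finset.range (n + 1 - q + 1), ∑ p' ∈ Finset.range (n + 1 - q + 1 - q'),
        tcomp n (-3) p (tcomp (n + 1 - q) (-2) p' (mu.{u} (n + 1 - q + 1 - q')) (mu.{u} q'))
          (mu.{u} q) =
    ∑ q ∈ Finset.range (n + 1), ∑ p ∈ Finset.range (n + 1 - q),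
      ∑ q' ∈ Finset.range (q + 1), ∑ p' ∈ Finset.range (q + 1 - q'),
        tcomp n (-3) p (mu.{u} (n + 1 - q)) (tcomp q (-2) p' (mu.{u} (q + 1 - q')) (mu.{u} q')) := by
  have par : ∀ q p q' p' : ℕ, q < n + 1 → p < n + 1 - q → q' < n + 1 - q + 1 →
      p' < n + 1 - q + 1 - q' → p < p' →
      tcomp n (-3) p (tcomp (n + 1 - q) (-2) p' (mu.{u} (n + 1 - q + 1 - q')) (mu.{u} q'))
          (mu.{u} q) +
        tcomp n (-3) (p' + q - 1)
          (tcomp (n + 1 - q') (-2) p (mu.{u} (n + 1 - q' + 1 - q)) (mu.{u} q)) (mu.{u} q') = 0 := by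
    intro q p q' p' h1 h2 h3 h4 h5
    have hm : n + 1 - q' + 1 - q = n + 1 - q + 1 - q' := by omega
    rw [hm, ← tcomp_eq (c := -2) p' (by omega) (by omega) (by omega),
      ← tcomp_eq (c := -3) p (by omega) (by omega) (by omega),
      ← tcomp_eq (c := -2) p (by omega) (by omega) (by omega),
      ← tcomp_eq (c := -3) (p' + q - 1) (by omega) (by omega) (by omega),
      FreeObj.comp_parallel (l := n + 1 - q) (f := -2) p p' (p' + q - 1) h5 (by omega) (by omega)
        (by omega) (by omega) (by omega) (by omega) (by omega) (by omega) (by omega) (by omega)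
        (by omega) (by omega) (by omega)]
    have : ksign (-1 * -1) = -1 := by simp [ksign]
    rw [this, neg_smul, one_smul, add_neg_cancel]
  simp only [Finset.sum_sigma']
  rw [← Finset.sum_filter_add_sum_filter_not _
    (fun t : (_ : ℕ) × (_ : ℕ) × (_ : ℕ) × ℕ =>
      t.2.2.2 ≤ t.2.1 ∧ t.2.1 < t.2.2.2 + t.2.2.1)]
  conv_rhs => rw [← add_zero (Finset.sum _ _)]
  congr 1
  · refine Finset.sum_bij'
      (fun t _ => ⟨t.1 + t.2.2.1 - 1, t.2.2.2, t.1, t.2.1 - t.2.2.2⟩)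
      (fun t _ => ⟨t.2.2.1, t.2.1 + t.2.2.2, t.1 + 1 - t.2.2.1, t.2.1⟩) ?_ ?_ ?_ ?_ ?_
    · rintro ⟨q, p, q', p'⟩ h
      simp only [Finset.mem_filter, Finset.mem_sigma, Finset.mem_range] at h ⊢
      omega
    · rintro ⟨q, p, q', p'⟩ h
      simp only [Finset.mem_filter, Finset.mem_sigma, Finset.mem_range] at h ⊢
      omega
    · rintro ⟨q, p, q', p'⟩ h
      simp only [Finset.mem_filter, Finset.mem_sigma, Finset.mem_range] at h
      have e1 : p' + (p - p') = p := by omega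
      have e2 : q + q' - 1 + 1 - q = q' := by omega
      simp only [e1, e2]
    · rintro ⟨q, p, q', p'⟩ h
      simp only [Finset.mem_sigma, Finset.mem_range] at h
      have e1 : p + p' - p = p' := by omega
      have e2 : q' + (q + 1 - q') - 1 = q := by omega
      simp only [e1, e2]
    · rintro ⟨q, p, q', p'⟩ h
      simp only [Finset.mem_filter, Finset.mem_sigma, Finset.mem_range] at h
      have e1 : q + q' - 1 + 1 - q = q' := by omega
      have e2 : n + 1 - (q + q' - 1) = n + 1 - q + 1 - q' := by omega
      obtain ⟨j, rfl⟩ : ∃ j, p = p' + j := ⟨p - p', by omega⟩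
      have e3 : p' + j - p' = j := by omega
      dsimp only
      rw [e1, e2, e3, ← tcomp_eq (c := -2) p' (by omega) (by omega) (by omega),
        ← tcomp_eq (c := -3) (p' + j) (by omega) (by omega) (by omega),
        ← tcomp_eq (c := -2) j (by omega) (by omega) (by omega),
        ← tcomp_eq (c := -3) p' (by omega) (by omega) (by omega)]
      apply FreeObj.comp_assoc
  · refine Finset.sum_involution
      (fun t _ => if t.2.1 < t.2.2.2 then ⟨t.2.2.1, t.2.2.2 + t.1 - 1, t.1, t.2.1⟩
        else ⟨t.2.2.1, t.2.2.2, t.1, t.2.1 + 1 - t.2.2.1⟩) ?_ ?_ ?_ ?_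
    · rintro ⟨q, p, q', p'⟩ h
      simp only [Finset.mem_filter, Finset.mem_sigma, Finset.mem_range] at h
      dsimp only
      by_cases hlt : p < p'
      · rw [if_pos hlt]
        exact par q p q' p' (by omega) (by omega) (by omega) (by omega) hlt
      · rw [if_neg hlt]
        have := par q' p' q (p + 1 - q') (by omega) (by omega) (by omega) (by omega) (by omega)
        have e : p + 1 - q' + q' - 1 = p := by omega
        rw [e] at this
        rw [add_comm]
        exact this
    · rintro ⟨q, p, q', p'⟩ h _ heq
      simp only [Finset.mem_filter, Finset.mem_sigma, Finset.mem_range] at h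
      dsimp only at heq
      by_cases hlt : p < p'
      · rw [if_pos hlt] at heq
        simp only [Sigma.mk.injEq, heq_eq_eq] at heq
        omega
      · rw [if_neg hlt] at heq
        simp only [Sigma.mk.injEq, heq_eq_eq] at heq
        omega
    · rintro ⟨q, p, q', p'⟩ h
      simp only [Finset.mem_filter, Finset.mem_sigma, Finset.mem_range] at h
      dsimp only
      by_cases hlt : p < p'
      · rw [if_pos hlt]
        simp only [Finset.mem_filter, Finset.mem_sigma, Finset.mem_range]
        omega
      · rw [if_neg hlt]
        simp only [Finset.mem_filter, Finset.mem_sigma, Finset.mem_range]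
        omega
    · rintro ⟨q, p, q', p'⟩ h
      simp only [Finset.mem_filter, Finset.mem_sigma, Finset.mem_range] at h
      dsimp only
      by_cases hlt : p < p'
      · have e : p' + q - 1 + 1 - q = p' := by omega
        rw [if_pos hlt]
        dsimp only
        rw [if_neg (by omega), e]
      · have e : p + 1 - q' + q' - 1 = p := by omega
        rw [if_neg hlt]
        dsimp only
        rw [if_pos (by omega), e]

theorem caGenDiff_sq {n : ℕ} {a : ℤ} (x : CAGen.{u} n a) (b c : ℤ) (hb : b + 1 = a)
    (hc : c + 1 = b) : FreeObj.deriv caGenDiff.{u} hc (caGenDiff x b hb) = 0 := by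
  cases x with
  | mu =>
    obtain rfl : b = -2 := by omega
    obtain rfl : c = -3 := by omega
    change FreeObj.deriv caGenDiff.{u} hc (muDiff n (-2) hb) = 0
    have step : FreeObj.deriv caGenDiff.{u} hc (muDiff.{u} n (-2) hb) =
        - ∑ q : Fin (n + 1), ∑ p : Fin (n + 1 - q),
          (tcomp n (-3) p (muDiff (n + 1 - q) (-2) hb) (mu q) -
            tcomp n (-3) p (mu (n + 1 - q)) (muDiff q (-2) hb)) := by
      rw [muDiff, map_neg, map_sum]
      congr 1
      refine Finset.sum_congr rfl fun q _ => ?_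
      rw [map_sum]
      refine Finset.sum_congr rfl fun p _ => ?_
      rw [FreeObj.deriv_comp caGenDiff (p : ℕ) p.2 (a' := -2) (b' := -2) _ _ hb hb hc (by omega)
        (by omega), deriv_mu, deriv_mu, tcomp_eq, tcomp_eq, ksign_neg_one, neg_smul, one_smul,
        sub_eq_add_neg]
    have tneg : ∀ {m n k : ℕ} {a b c : ℤ} (i : ℕ) (x : FreeObj CAGen.{u} m a)
        (y : FreeObj CAGen.{u} n b), tcomp k c i (-x) y = - tcomp k c i x y := by
      intros; unfold tcomp; split_ifs <;> simp
    have tneg' : ∀ {m n k : ℕ} {a b c : ℤ} (i : ℕ) (x : FreeObj CAGen.{u} m a)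
        (y : FreeObj CAGen.{u} n b), tcomp k c i x (-y) = - tcomp k c i x y := by
      intros; unfold tcomp; split_ifs <;> simp
    rw [step]
    simp only [muDiff_eq, tneg, tneg', sum_tcomp, tcomp_sum, Finset.sum_sub_distrib,
      Finset.sum_neg_distrib]
    have key := mu_sum.{u} n
    simp only [Finset.sum_range (n := n + 1), Finset.sum_range (n := n + 1 - _)] at key
    simp only [Finset.sum_range] at key ⊢
    rw [key]
    simp

/-- The curved A-infinity operad: the free operad on `μ_n`, `n ≥ 0`, of arity `n` and degree `-1`,
with `d μ_n = - ∑_{p+q+r=n} μ_{p+1+r} ∘_{p+1} μ_q`. -/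
def cAInf : DGOperad.{u} where
  toGrOperad := FreeOperad CAGen.{u}
  d := FreeObj.deriv caGenDiff.{u}
  d_comp := FreeObj.deriv_comp caGenDiff.{u}
  d_d := FreeObj.deriv_deriv caGenDiff.{u} caGenDiff_sq

/-- The sub-operad `⟨μ_i⟩_{i > 0}` of the underlying graded operad of `cAInf`. -/
def cAInfPos : SubOperad cAInf.{u}.toGrOperad :=
  SubOperad.closure fun n a => {x | 0 < n ∧ ∃ g : CAGen.{u} n a, x = FreeOperad.gen g}

/-! ### The category of curved operads -/

/-- The generator `κ`, of arity `0` and degree `-1`. -/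
inductive KGen : ℕ → ℤ → Type u
  | kappa : KGen 0 (-1)

/-- The operad `[κ]` generated by a single operation of arity `0` and degree `-1`. -/
abbrev kappaOperad : GrOperad.{u} := FreeOperad KGen.{u}

/-- The morphism `[κ] ⟶ Q` classified by an operation of arity `0` and degree `-1`. -/
def kappaHom (Q : GrOperad.{u}) (κ : Q.obj 0 (-1)) : kappaOperad.{u} ⟶ Q :=
  FreeOperad.lift Q (fun {_ _} g => match g with | .kappa => κ)

/-- Operadic expressions in elements of `Q₀` and `κ` in which `κ` appears exactly `w` times. -/
inductive IsMonomial {Q : GrOperad.{u}} (κ : Q.obj 0 (-1)) (Q₀ : SubOperad Q) :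
    ℕ → ∀ {n : ℕ} {a : ℤ}, Q.obj n a → Prop
  | base {n : ℕ} {a : ℤ} {x : Q.obj n a} : x ∈ Q₀.carrier n a → IsMonomial κ Q₀ 0 x
  | kappa : IsMonomial κ Q₀ 1 κ
  | comp {v w m n k : ℕ} {a b c : ℤ} (i : ℕ) (hi : i < m) (hk : m + n = k + 1) (hc : a + b = c)
      {x : Q.obj m a} {y : Q.obj n b} : IsMonomial κ Q₀ v x → IsMonomial κ Q₀ w y →
      IsMonomial κ Q₀ (v + w) (Q.comp i hi hk hc x y)

/-- The weight `w` part of `Q`: the span of the expressions in which `κ` appears `w` times. -/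
def weightPart {Q : GrOperad.{u}} (κ : Q.obj 0 (-1)) (Q₀ : SubOperad Q) (w n : ℕ) (a : ℤ) :
    AddSubgroup (Q.obj n a) :=
  AddSubgroup.closure {x | IsMonomial κ Q₀ w x}

/-- The conditions on a quadruple `(Q, d, κ, Q₀)` for being an object of `Curv`. -/
structure IsCurved (Q : DGOperad.{u}) (κ : Q.obj 0 (-1)) (Q₀ : SubOperad Q.toGrOperad) :
    Prop where
  kappa_notMem : κ ∉ Q₀.carrier 0 (-1)
  /-- `Q` is the coproduct `Q₀ ∨ [κ]` in graded operads. -/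
  isCoproduct : Nonempty (Limits.IsColimit
    (Limits.BinaryCofan.mk Q₀.incl (kappaHom Q.toGrOperad κ)))
  /-- `d = d₀ + d₁`, where `dᵢ` raises the weight by `i`, and `d₁ κ = 0`. (As `Q` is the direct sum
  of its weight parts by the previous condition, `d₀` and `d₁` are determined by `d`.) -/
  strictMixed : ∃ d₀ d₁ : Q.toGrOperad.LowerMap,
    (∀ {n : ℕ} {a b : ℤ} (h : b + 1 = a) (x : Q.obj n a), Q.d h x = d₀ h x + d₁ h x) ∧
    (∀ {n : ℕ} {a b : ℤ} (h : b + 1 = a) (w : ℕ) (x : Q.obj n a),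
      x ∈ weightPart κ Q₀ w n a → d₀ h x ∈ weightPart κ Q₀ w n b) ∧
    (∀ {n : ℕ} {a b : ℤ} (h : b + 1 = a) (w : ℕ) (x : Q.obj n a),
      x ∈ weightPart κ Q₀ w n a → d₁ h x ∈ weightPart κ Q₀ (w + 1) n b) ∧
    (∀ {b : ℤ} (h : b + 1 = -1), d₁ h κ = 0)

/-- Objects of `Curv`. -/
structure Curv where
  Q : DGOperad.{u}
  κ : Q.obj 0 (-1)
  Q₀ : SubOperad Q.toGrOperad
  isCurved : IsCurved Q κ Q₀

/-- Morphisms of `Curv`: morphisms of dg operads that send `κ` to `κ` and `Q₀` into `Q₀`. -/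
@[ext]
structure Curv.Hom (P Q : Curv.{u}) extends toDGHom : DGOperad.Hom P.Q Q.Q where
  map_kappa : map P.κ = Q.κ
  map_mem : ∀ {n : ℕ} {a : ℤ} (x : P.Q.obj n a),
    x ∈ P.Q₀.carrier n a → map x ∈ Q.Q₀.carrier n a

instance : Category Curv.{u} where
  Hom := Curv.Hom
  id P :=
    { map := AddMonoidHom.id _
      map_one := rfl
      map_comp := fun _ _ _ _ _ _ => rfl
      map_d := fun _ _ => rfl
      map_kappa := rfl
      map_mem := fun _ h => h }
  comp f g :=
    { map := g.map.comp f.map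
      map_one := by simp [f.map_one, g.map_one]
      map_comp := by intros; simp [f.map_comp, g.map_comp]
      map_d := by intros; simp [f.map_d, g.map_d]
      map_kappa := by simp [f.map_kappa, g.map_kappa]
      map_mem := fun x h => g.map_mem _ (f.map_mem x h) }

end CurvedOperad

/-!
A morphism from `cA∞` to an object `(Q, d, κ, Q₀)` of `Curv` is a family of operations `m_n` with
`m_0 = κ` and `m_n ∈ Q₀` for `n > 0` such that `S m_{n+1} = -d m_n - ∑_{q>0} m_{p+1+r} ∘_{p+1} m_q`
for all `n`, where `S x` is the sum of the insertions of `κ` into the inputs of `x`. The operator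
`S` is injective on `Q₀` in positive arities, which gives uniqueness. In positive arities, every
operation of weight at most one that is annihilated by `S` is the image of an operation of `Q₀`;
since `d² = 0` forces `S` to annihilate the right hand side, `m_{n+1}` exists. In arity `0` the
right hand side is `-dκ`, which has weight one because `d₁ κ = 0`, so it is an image as well.

Both properties of `S` come from the derivative with respect to `κ`: as `Q` is the coproduct of `Q₀`
and `[κ]`, a morphism to the square-zero extension of `Q` by the operations with a marked input
yields the derivation that vanishes on `Q₀` and turns `κ` into a marked input. Marking the first
input is a contracting homotopy for `S`.
-/

namespace CurvedOperad

/-! ### Sub-operads and morphisms -/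

section SubOperads

variable {P Q R : GrOperad.{u}}

theorem GrOperad.Hom.ext_apply {f g : GrOperad.Hom P Q}
    (h : ∀ {n : ℕ} {a : ℤ} (x : P.obj n a), f.map x = g.map x) : f = g :=
  GrOperad.Hom.ext (funext fun _ => funext fun _ => AddMonoidHom.ext h)

theorem SubOperad.subset_closure (s : ∀ (n : ℕ) (a : ℤ), Set (Q.obj n a)) (n : ℕ) (a : ℤ) :
    s n a ⊆ (closure s).carrier n a := fun _ hx =>
  AddSubgroup.mem_iInf.mpr fun S => S.2 n a hx

theorem SubOperad.closure_le {s : ∀ (n : ℕ) (a : ℤ), Set (Q.obj n a)} {S : SubOperad Q}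
    (h : ∀ n a, s n a ⊆ S.carrier n a) (n : ℕ) (a : ℤ) :
    (closure s).carrier n a ≤ S.carrier n a :=
  iInf_le _ (⟨S, h⟩ : {S : SubOperad Q // ∀ n a, s n a ⊆ S.carrier n a})

/-- The preimage of a sub-operad. -/
def SubOperad.comap (f : GrOperad.Hom P Q) (S : SubOperad Q) : SubOperad P where
  carrier n a := (S.carrier n a).comap f.map
  one_mem := by simpa only [AddSubgroup.mem_comap, f.map_one] using S.one_mem
  comp_mem i hi hk hc _ _ hx hy := by
    simpa only [AddSubgroup.mem_comap, f.map_comp] using S.comp_mem i hi hk hc hx hy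

/-- The image of a sub-operad. -/
def SubOperad.map (f : GrOperad.Hom P Q) (S : SubOperad P) : SubOperad Q where
  carrier n a := (S.carrier n a).map f.map
  one_mem := ⟨P.one, S.one_mem, f.map_one⟩
  comp_mem := by
    rintro m n k a b c i hi hk hc _ _ ⟨x, hx, rfl⟩ ⟨y, hy, rfl⟩
    exact ⟨_, S.comp_mem i hi hk hc hx hy, f.map_comp i hi hk hc x y⟩

/-- The sub-operad of the operations on which two morphisms agree. -/
def SubOperad.eqLocus (f g : GrOperad.Hom P Q) : SubOperad P where
  carrier _ _ := f.map.eqLocus g.map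
  one_mem := f.map_one.trans g.map_one.symm
  comp_mem := by
    intro m n k a b c i hi hk hc x y (hx : f.map x = g.map x) (hy : f.map y = g.map y)
    change f.map (P.comp i hi hk hc x y) = g.map (P.comp i hi hk hc x y)
    rw [f.map_comp, g.map_comp, hx, hy]

theorem SubOperad.closure_hom_ext {s : ∀ (n : ℕ) (a : ℤ), Set (Q.obj n a)}
    {f g : GrOperad.Hom (closure s).toOperad R}
    (h : ∀ {n : ℕ} {a : ℤ} (x : Q.obj n a) (hx : x ∈ s n a),
      f.map ⟨x, subset_closure s n a hx⟩ = g.map ⟨x, subset_closure s n a hx⟩) : f = g := by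
  have hle := closure_le (S := (eqLocus f g).map (closure s).incl)
    fun n a x hx => ⟨⟨x, subset_closure s n a hx⟩, h x hx, rfl⟩
  refine GrOperad.Hom.ext_apply fun {n a} x => ?_
  obtain ⟨y, hy, hyx⟩ := hle n a x.2
  obtain rfl : y = x := Subtype.ext hyx
  exact hy

end SubOperads

section Free

variable {X : ℕ → ℤ → Type u}

theorem FreeOperad.mem_of_gen_mem {S : SubOperad (FreeOperad X)}
    (h : ∀ {n : ℕ} {a : ℤ} (x : X n a), gen x ∈ S.carrier n a) {n : ℕ} {a : ℤ}
    (x : (FreeOperad X).obj n a) : x ∈ S.carrier n a := by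
  induction x using FreeObj.ind with
  | h x =>
    induction x with
    | gen x => exact h x
    | one => exact S.one_mem
    | comp i hi hk hc x y ihx ihy => exact S.comp_mem i hi hk hc ihx ihy
    | zero => exact (S.carrier _ _).zero_mem
    | add x y ihx ihy => exact (S.carrier _ _).add_mem ihx ihy
    | neg x ihx => exact (S.carrier _ _).neg_mem ihx

theorem FreeOperad.hom_ext {R : GrOperad.{u}} {f g : GrOperad.Hom (FreeOperad X) R}
    (h : ∀ {n : ℕ} {a : ℤ} (x : X n a), f.map (gen x) = g.map (gen x)) : f = g :=
  GrOperad.Hom.ext_apply (mem_of_gen_mem (S := SubOperad.eqLocus f g) h)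

end Free

/-! ### Derivations -/

section Derivations

variable {P Q : GrOperad.{u}}

/-- Derivations of degree `-1` of a graded operad. -/
def IsDerivation (D : Q.LowerMap) : Prop :=
  ∀ {m n k : ℕ} {a b c a' b' c' : ℤ} (i : ℕ) (hi : i < m) (hk : m + n = k + 1)
    (hc : a + b = c) (ha' : a' + 1 = a) (hb' : b' + 1 = b) (hc' : c' + 1 = c)
    (h₁ : a' + b = c') (h₂ : a + b' = c') (x : Q.obj m a) (y : Q.obj n b),
    D hc' (Q.comp i hi hk hc x y) =
      Q.comp i hi hk h₁ (D ha' x) y + ksign a • Q.comp i hi hk h₂ x (D hb' y)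

theorem isDerivation_deriv {X : ℕ → ℤ → Type u}
    (δ : ∀ {n : ℕ} {a : ℤ}, X n a → ∀ b : ℤ, b + 1 = a → FreeObj X n b) :
    IsDerivation (Q := FreeOperad X) (FreeObj.deriv δ) :=
  FreeObj.deriv_comp δ

theorem IsDerivation.add {D D' : Q.LowerMap} (hD : IsDerivation D) (hD' : IsDerivation D') :
    IsDerivation (Q := Q) (fun h => D h + D' h) := by
  intro m n k a b c a' b' c' i hi hk hc ha' hb' hc' h₁ h₂ x y
  simp only [AddMonoidHom.add_apply, map_add, smul_add,
    hD i hi hk hc ha' hb' hc' h₁ h₂, hD' i hi hk hc ha' hb' hc' h₁ h₂]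
  abel

theorem IsDerivation.map_one {D : Q.LowerMap} (hD : IsDerivation D) {b : ℤ} (h : b + 1 = 0) :
    D h Q.one = 0 := by
  obtain rfl : b = -1 := by omega
  have hone : D h Q.one = D h Q.one + D h Q.one := by
    have := hD 0 Nat.one_pos rfl (add_zero 0) h h h (add_zero _) (zero_add _) Q.one Q.one
    rwa [Q.comp_one, Q.comp_one, ksign_of_even Even.zero, one_smul, Q.one_comp] at this
  exact left_eq_add.mp hone

/-- The failure of a morphism to intertwine two operators of degree `-1`. -/
def derivDefect (f : GrOperad.Hom P Q) (D : P.LowerMap) (D' : Q.LowerMap) {n : ℕ} {a b : ℤ}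
    (h : b + 1 = a) : P.obj n a →+ Q.obj n b :=
  (D' h).comp f.map - f.map.comp (D h)

variable (f : GrOperad.Hom P Q) {D : P.LowerMap} {D' : Q.LowerMap}

theorem derivDefect_comp (hD : IsDerivation D) (hD' : IsDerivation D') {m n k : ℕ}
    {a b c a' b' c' : ℤ} (i : ℕ) (hi : i < m) (hk : m + n = k + 1) (hc : a + b = c)
    (ha' : a' + 1 = a) (hb' : b' + 1 = b) (hc' : c' + 1 = c) (h₁ : a' + b = c')
    (h₂ : a + b' = c') (x : P.obj m a) (y : P.obj n b) :
    derivDefect f D D' hc' (P.comp i hi hk hc x y) =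
      Q.comp i hi hk h₁ (derivDefect f D D' ha' x) (f.map y) +
        ksign a • Q.comp i hi hk h₂ (f.map x) (derivDefect f D D' hb' y) := by
  simp only [derivDefect, AddMonoidHom.sub_apply, AddMonoidHom.comp_apply, f.map_comp,
    hD i hi hk hc ha' hb' hc' h₁ h₂, hD' i hi hk hc ha' hb' hc' h₁ h₂, map_add, map_zsmul,
    map_sub, smul_sub]
  abel

/-- The sub-operad of the operations on which a morphism intertwines two derivations. -/
def IsDerivation.intertwiningLocus (hD : IsDerivation D) (hD' : IsDerivation D') :
    SubOperad P where
  carrier n a := ⨅ b, ⨅ h : b + 1 = a, (derivDefect f D D' h).ker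
  one_mem := by
    simp only [AddSubgroup.mem_iInf, AddMonoidHom.mem_ker, derivDefect, AddMonoidHom.sub_apply,
      AddMonoidHom.comp_apply, f.map_one, hD.map_one, hD'.map_one, map_zero, sub_zero,
      implies_true]
  comp_mem {m n k a b c} i hi hk hc x y hx hy := by
    simp only [AddSubgroup.mem_iInf, AddMonoidHom.mem_ker] at hx hy ⊢
    intro c' hc'
    rw [derivDefect_comp f hD hD' (a' := a - 1) (b' := b - 1) i hi hk hc (by omega) (by omega) hc'
      (by omega) (by omega), hx, hy, map_zero, map_zero, smul_zero, AddMonoidHom.zero_apply,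
      add_zero]

theorem FreeOperad.derivDefect_eq_zero {X : ℕ → ℤ → Type u} {D : (FreeOperad X).LowerMap}
    (hD : IsDerivation D) (hD' : IsDerivation D') (f : GrOperad.Hom (FreeOperad X) Q)
    (h : ∀ {n : ℕ} {a b : ℤ} (h : b + 1 = a) (x : X n a), derivDefect f D D' h (gen x) = 0)
    {n : ℕ} {a b : ℤ} (hb : b + 1 = a) (x : (FreeOperad X).obj n a) :
    derivDefect f D D' hb x = 0 := by
  have hx := mem_of_gen_mem (S := hD.intertwiningLocus f hD')
    (fun x => by simpa only [IsDerivation.intertwiningLocus, AddSubgroup.mem_iInf,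
      AddMonoidHom.mem_ker] using
      fun b hb => h hb x) x
  simp only [IsDerivation.intertwiningLocus, AddSubgroup.mem_iInf, AddMonoidHom.mem_ker] at hx
  exact hx b hb

end Derivations

/-! ### Operations with a marked input -/

section Marked

variable {Q : GrOperad.{u}} {m n p k l r : ℕ} {a b c e f g : ℤ}

/-- Composition of operations with a marked input (`X t` has its input `t` marked) with an
unmarked operation that is inserted after the marked input. The sign is that of moving a symbol of
degree `-1`, which stands for the operation to be plugged into the marked input, past `y`. -/
def markedBefore (i : ℕ) (hi : i < m) (hk : m + n = k + 1) (hc : a + b = c) :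
    (ℕ → Q.obj (m + 1) (a + 1)) →+ Q.obj n b →+ (ℕ → Q.obj (k + 1) (c + 1)) :=
  AddMonoidHom.mk' (fun X => AddMonoidHom.pi fun t => if t ≤ i then
      ksign b • Q.comp (i + 1) (by omega) (by omega) (by omega) (X t) else 0) fun X X' => by
    ext y t
    simp only [AddMonoidHom.pi_apply, AddMonoidHom.add_apply, Pi.add_apply]
    split_ifs <;> simp

/-- As `markedBefore`, for an unmarked operation that is inserted before the marked input. -/
def markedAfter (i : ℕ) (hi : i < m) (hk : m + n = k + 1) (hc : a + b = c) :
    (ℕ → Q.obj (m + 1) (a + 1)) →+ Q.obj n b →+ (ℕ → Q.obj (k + 1) (c + 1)) :=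
  AddMonoidHom.mk' (fun X => AddMonoidHom.pi fun t => if i + n ≤ t then
      ksign b • Q.comp i (by omega) (by omega) (by omega) (X (t + 1 - n)) else 0) fun X X' => by
    ext y t
    simp only [AddMonoidHom.pi_apply, AddMonoidHom.add_apply, Pi.add_apply]
    split_ifs <;> simp

/-- Composition of an unmarked operation with operations with a marked input. -/
def markedInside (i : ℕ) (hi : i < m) (hk : m + n = k + 1) (hc : a + b = c) :
    Q.obj m a →+ (ℕ → Q.obj (n + 1) (b + 1)) →+ (ℕ → Q.obj (k + 1) (c + 1)) :=
  AddMonoidHom.flip <| AddMonoidHom.mk' (fun Y => AddMonoidHom.pi fun t =>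
      if i ≤ t ∧ t ≤ i + n then
        (Q.comp i hi (by omega) (by omega)).flip (Y (t - i)) else 0) fun Y Y' => by
    ext x t
    simp only [AddMonoidHom.pi_apply, AddMonoidHom.add_apply, Pi.add_apply]
    split_ifs <;> simp

theorem markedBefore_apply {i : ℕ} (hi : i < m) (hk : m + n = k + 1) (hc : a + b = c)
    (X : ℕ → Q.obj (m + 1) (a + 1)) (y : Q.obj n b) (t : ℕ) :
    markedBefore i hi hk hc X y t = if t ≤ i then
      ksign b • Q.comp (i + 1) (by omega) (by omega) (by omega) (X t) y else 0 := by
  simp only [markedBefore, AddMonoidHom.mk'_apply, AddMonoidHom.pi_apply]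
  split_ifs <;> rfl

theorem markedAfter_apply {i : ℕ} (hi : i < m) (hk : m + n = k + 1) (hc : a + b = c)
    (X : ℕ → Q.obj (m + 1) (a + 1)) (y : Q.obj n b) (t : ℕ) :
    markedAfter i hi hk hc X y t = if i + n ≤ t then
      ksign b • Q.comp i (by omega) (by omega) (by omega) (X (t + 1 - n)) y else 0 := by
  simp only [markedAfter, AddMonoidHom.mk'_apply, AddMonoidHom.pi_apply]
  split_ifs <;> rfl

theorem markedInside_apply {i : ℕ} (hi : i < m) (hk : m + n = k + 1) (hc : a + b = c)
    (x : Q.obj m a) (Y : ℕ → Q.obj (n + 1) (b + 1)) (t : ℕ) :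
    markedInside i hi hk hc x Y t = if i ≤ t ∧ t ≤ i + n then
      Q.comp i hi (by omega) (by omega) x (Y (t - i)) else 0 := by
  simp only [markedInside, AddMonoidHom.flip_apply, AddMonoidHom.mk'_apply, AddMonoidHom.pi_apply]
  split_ifs <;> rfl

theorem GrOperad.comp_assoc' (i j i' : ℕ) (hi' : i' = i + j) (hi : i < m) (hj : j < n)
    (hik : i' < k) (hk : m + n = k + 1) (hr : k + p = r + 1)
    (hl : n + p = l + 1) (hr' : m + l = r + 1)
    (he : a + b = e) (hg : e + c = g) (hf : b + c = f) (hg' : a + f = g)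
    (x : Q.obj m a) (y : Q.obj n b) (z : Q.obj p c) :
    Q.comp i' hik hr hg (Q.comp i hi hk he x y) z =
      Q.comp i hi hr' hg' x (Q.comp j hj hl hf y z) := by
  subst hi'
  exact Q.comp_assoc i j hi hj hik hk hr hl hr' he hg hf hg' x y z

theorem GrOperad.smul_comp_parallel {u v : ℤ} (i j j' : ℕ) (huv : u * ksign (b * c) = v)
    (hij : i < j) (hi : i < m) (hj : j < m) (hj' : j + n = j' + 1) (hjk : j' < k) (hil : i < l)
    (hk : m + n = k + 1) (hr : k + p = r + 1) (hl : m + p = l + 1) (hr' : l + n = r + 1)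
    (he : a + b = e) (hg : e + c = g) (hf : a + c = f) (hg' : f + b = g)
    (x : Q.obj m a) (y : Q.obj n b) (z : Q.obj p c) :
    u • Q.comp j' hjk hr hg (Q.comp i hi hk he x y) z =
      v • Q.comp i hil hr' hg' (Q.comp j hj hl hf x z) y := by
  rw [Q.comp_parallel i j j' hij hi hj hj' hjk hil hk hr hl hr' he hg hf hg', smul_smul, huv]

section Sequential

variable {i j : ℕ} (hi : i < m) (hj : j < n) (hij : i + j < k) (hk : m + n = k + 1)
  (hr : k + p = r + 1) (hl : n + p = l + 1) (hr' : m + l = r + 1) (he : a + b = e)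
  (hg : e + c = g) (hf : b + c = f) (hg' : a + f = g)

theorem markedBefore_markedBefore_assoc (X : ℕ → Q.obj (m + 1) (a + 1)) (y : Q.obj n b)
    (z : Q.obj p c) :
    markedBefore (i + j) hij hr hg (markedBefore i hi hk he X y) z =
      markedBefore i hi hr' hg' X (Q.comp j hj hl hf y z) := by
  have hs : ksign c * ksign b = ksign f := by rw [← hf, ksign_add, mul_comm]
  funext t
  simp only [markedBefore_apply]
  by_cases h : t ≤ i
  · rw [if_pos h, if_pos h, if_pos (by omega), map_zsmul, AddMonoidHom.smul_apply, smul_smul, hs]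
    congr 1
    apply Q.comp_assoc'; omega
  · simp only [if_neg h, map_zero, AddMonoidHom.zero_apply, smul_zero, ite_self]

theorem markedAfter_markedAfter_assoc (X : ℕ → Q.obj (m + 1) (a + 1)) (y : Q.obj n b)
    (z : Q.obj p c) :
    markedAfter (i + j) hij hr hg (markedAfter i hi hk he X y) z =
      markedAfter i hi hr' hg' X (Q.comp j hj hl hf y z) := by
  have hs : ksign c * ksign b = ksign f := by rw [← hf, ksign_add, mul_comm]
  funext t
  simp only [markedAfter_apply]
  by_cases h : i + l ≤ t
  · rw [if_pos h, if_pos (by omega), if_pos (by omega), map_zsmul, AddMonoidHom.smul_apply,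
      smul_smul, hs, show t + 1 - p + 1 - n = t + 1 - l by omega]
    congr 1
    apply Q.comp_assoc
  · rw [if_neg h]
    split_ifs with h₁ h₂
    · omega
    · rw [map_zero, AddMonoidHom.zero_apply, smul_zero]
    · rfl

theorem markedBefore_markedInside_assoc (x : Q.obj m a) (Y : ℕ → Q.obj (n + 1) (b + 1))
    (z : Q.obj p c) :
    markedBefore (i + j) hij hr hg (markedInside i hi hk he x Y) z =
      markedInside i hi hr' hg' x (markedBefore j hj hl hf Y z) := by
  funext t
  simp only [markedBefore_apply, markedInside_apply]
  by_cases h : i ≤ t ∧ t ≤ i + j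
  · rw [if_pos h.2, if_pos (by omega), if_pos (by omega), if_pos (by omega), map_zsmul]
    congr 1
    apply Q.comp_assoc'; omega
  · split_ifs <;> first | omega | simp only [map_zero, AddMonoidHom.zero_apply, smul_zero]

theorem markedAfter_markedInside_assoc (x : Q.obj m a) (Y : ℕ → Q.obj (n + 1) (b + 1))
    (z : Q.obj p c) :
    markedAfter (i + j) hij hr hg (markedInside i hi hk he x Y) z =
      markedInside i hi hr' hg' x (markedAfter j hj hl hf Y z) := by
  funext t
  simp only [markedAfter_apply, markedInside_apply]
  by_cases h : i + j + p ≤ t ∧ t ≤ i + l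
  · rw [if_pos h.1, if_pos (by omega), if_pos (by omega), if_pos (by omega), map_zsmul,
      show t + 1 - p - i = t - i + 1 - p by omega]
    congr 1
    apply Q.comp_assoc
  · split_ifs <;> first | omega | simp only [map_zero, AddMonoidHom.zero_apply, smul_zero]

theorem markedInside_assoc (x : Q.obj m a) (y : Q.obj n b) (Z : ℕ → Q.obj (p + 1) (c + 1)) :
    markedInside (i + j) hij hr hg (Q.comp i hi hk he x y) Z =
      markedInside i hi hr' hg' x (markedInside j hj hl hf y Z) := by
  funext t
  simp only [markedInside_apply]
  by_cases h : i + j ≤ t ∧ t ≤ i + j + p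
  · rw [if_pos h, if_pos (by omega), if_pos (by omega), show t - (i + j) = t - i - j by omega]
    apply Q.comp_assoc
  · split_ifs <;> first | omega | simp only [map_zero]

end Sequential

section Disjoint

variable {i i' : ℕ} (hi : i < m) (hi' : i' < k) (hk : m + n = k + 1) (hr : k + p = r + 1)
  (he : a + b = e) (hg : e + c = g)

theorem markedBefore_markedAfter_eq_zero (h : i' < i + n) (X : ℕ → Q.obj (m + 1) (a + 1))
    (y : Q.obj n b) (z : Q.obj p c) :
    markedBefore i' hi' hr hg (markedAfter i hi hk he X y) z = 0 := by
  funext t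
  simp only [markedBefore_apply, markedAfter_apply, Pi.zero_apply]
  split_ifs <;> first | omega | simp only [map_zero, AddMonoidHom.zero_apply, smul_zero]

theorem markedAfter_markedBefore_eq_zero (h : i ≤ i') (X : ℕ → Q.obj (m + 1) (a + 1))
    (y : Q.obj n b) (z : Q.obj p c) :
    markedAfter i' hi' hr hg (markedBefore i hi hk he X y) z = 0 := by
  funext t
  simp only [markedAfter_apply, markedBefore_apply, Pi.zero_apply]
  split_ifs <;> first | omega | simp only [map_zero, AddMonoidHom.zero_apply, smul_zero]

theorem markedAfter_markedInside_eq_zero (h : i + n ≤ i') (x : Q.obj m a)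
    (Y : ℕ → Q.obj (n + 1) (b + 1)) (z : Q.obj p c) :
    markedAfter i' hi' hr hg (markedInside i hi hk he x Y) z = 0 := by
  funext t
  simp only [markedAfter_apply, markedInside_apply, Pi.zero_apply]
  split_ifs <;> first | omega | simp only [map_zero, AddMonoidHom.zero_apply, smul_zero]

theorem markedBefore_markedInside_eq_zero (h : i' < i) (x : Q.obj m a)
    (Y : ℕ → Q.obj (n + 1) (b + 1)) (z : Q.obj p c) :
    markedBefore i' hi' hr hg (markedInside i hi hk he x Y) z = 0 := by
  funext t
  simp only [markedBefore_apply, markedInside_apply, Pi.zero_apply]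
  split_ifs <;> first | omega | simp only [map_zero, AddMonoidHom.zero_apply, smul_zero]

end Disjoint

section Parallel

variable {i j j' : ℕ} (hij : i < j) (hi : i < m) (hj : j < m) (hj' : j + n = j' + 1)
  (hjk : j' < k) (hil : i < l) (hk : m + n = k + 1) (hr : k + p = r + 1) (hl : m + p = l + 1)
  (hr' : l + n = r + 1) (he : a + b = e) (hg : e + c = g) (hf : a + c = f) (hg' : f + b = g)

include hij hj'

theorem markedBefore_markedBefore_parallel (X : ℕ → Q.obj (m + 1) (a + 1)) (y : Q.obj n b)
    (z : Q.obj p c) :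
    markedBefore j' hjk hr hg (markedBefore i hi hk he X y) z =
      ksign (b * c) • markedBefore i hil hr' hg' (markedBefore j hj hl hf X z) y := by
  have hs : ksign c * ksign b * ksign (b * c) = ksign (b * c) * (ksign b * ksign c) := by ring
  funext t
  simp only [markedBefore_apply, Pi.smul_apply]
  by_cases h : t ≤ i
  · simp (disch := omega) only [if_pos, map_zsmul, AddMonoidHom.smul_apply, smul_smul]
    apply Q.smul_comp_parallel (i + 1) (j + 1) (j' + 1) hs <;> omega
  · simp only [if_neg h, map_zero, AddMonoidHom.zero_apply, smul_zero, ite_self]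

theorem markedBefore_markedAfter_parallel (X : ℕ → Q.obj (m + 1) (a + 1)) (y : Q.obj n b)
    (z : Q.obj p c) :
    markedBefore j' hjk hr hg (markedAfter i hi hk he X y) z =
      ksign (b * c) • markedAfter i hil hr' hg' (markedBefore j hj hl hf X z) y := by
  have hs : ksign c * ksign b * ksign (b * c) = ksign (b * c) * (ksign b * ksign c) := by ring
  funext t
  simp only [markedBefore_apply, markedAfter_apply, Pi.smul_apply]
  by_cases h : i + n ≤ t ∧ t ≤ j'
  · simp (disch := omega) only [if_pos, map_zsmul, AddMonoidHom.smul_apply, smul_smul]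
    apply Q.smul_comp_parallel i (j + 1) (j' + 1) hs <;> omega
  · split_ifs <;> first | omega | simp only [map_zero, AddMonoidHom.zero_apply, smul_zero]

theorem markedAfter_markedAfter_parallel (X : ℕ → Q.obj (m + 1) (a + 1)) (y : Q.obj n b)
    (z : Q.obj p c) :
    markedAfter j' hjk hr hg (markedAfter i hi hk he X y) z =
      ksign (b * c) • markedAfter i hil hr' hg' (markedAfter j hj hl hf X z) y := by
  have hs : ksign c * ksign b * ksign (b * c) = ksign (b * c) * (ksign b * ksign c) := by ring
  funext t
  simp only [markedAfter_apply, Pi.smul_apply]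
  by_cases h : j' + p ≤ t
  · simp (disch := omega) only [if_pos, map_zsmul, AddMonoidHom.smul_apply, smul_smul,
      show t + 1 - p + 1 - n = t + 1 - n + 1 - p by omega]
    apply Q.smul_comp_parallel i j j' hs <;> omega
  · split_ifs <;> first | omega | simp only [map_zero, AddMonoidHom.zero_apply, smul_zero]

theorem markedBefore_markedInside_parallel (x : Q.obj m a) (Y : ℕ → Q.obj (n + 1) (b + 1))
    (z : Q.obj p c) :
    markedBefore j' hjk hr hg (markedInside i hi hk he x Y) z =
      ksign (b * c) • markedInside i hil hr' hg' (Q.comp j hj hl hf x z) Y := by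
  have hs : ksign c * ksign ((b + 1) * c) = ksign (b * c) := by
    rw [← ksign_add, show c + (b + 1) * c = b * c + (c + c) by ring, ksign_add, ksign_add c c,
      ksign_mul_self, mul_one]
  funext t
  simp only [markedBefore_apply, markedInside_apply, Pi.smul_apply]
  by_cases h : i ≤ t ∧ t ≤ i + n
  · simp (disch := omega) only [if_pos]
    apply Q.smul_comp_parallel i j (j' + 1) hs <;> omega
  · simp only [if_neg h, map_zero, AddMonoidHom.zero_apply, smul_zero, ite_self]

theorem markedInside_parallel (x : Q.obj m a) (y : Q.obj n b) (Z : ℕ → Q.obj (p + 1) (c + 1)) :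
    markedInside j' hjk hr hg (Q.comp i hi hk he x y) Z =
      ksign (b * c) • markedAfter i hil hr' hg' (markedInside j hj hl hf x Z) y := by
  have hs : 1 * ksign (b * (c + 1)) = ksign (b * c) * ksign b := by
    rw [one_mul, mul_add, mul_one, ksign_add]
  funext t
  simp only [markedAfter_apply, markedInside_apply, Pi.smul_apply]
  by_cases h : j' ≤ t ∧ t ≤ j' + p
  · simp (disch := omega) only [if_pos, smul_smul, show t - j' = t + 1 - n - j by omega]
    refine (one_smul ℤ _).symm.trans ?_
    apply Q.smul_comp_parallel i j j' hs <;> omega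
  · split_ifs <;> first | omega | simp only [map_zero, AddMonoidHom.zero_apply, smul_zero]

end Parallel
end Marked

section MarkedExtension

variable (Q : GrOperad.{u})

/-- Families of operations with a marked input, supported on the actual inputs. -/
def markedFamily (n : ℕ) (a : ℤ) : AddSubgroup (ℕ → Q.obj (n + 1) (a + 1)) where
  carrier := {X | ∀ t, n < t → X t = 0}
  zero_mem' := fun _ _ => rfl
  add_mem' := fun hX hY t ht => by rw [Pi.add_apply, hX t ht, hY t ht, add_zero]
  neg_mem' := fun hX t ht => by rw [Pi.neg_apply, hX t ht, neg_zero]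

section Membership

variable {Q} {m n k : ℕ} {a b c : ℤ} (i : ℕ) (hi : i < m) (hk : m + n = k + 1) (hc : a + b = c)

theorem markedBefore_mem {X : ℕ → Q.obj (m + 1) (a + 1)} (hX : X ∈ markedFamily Q m a)
    (y : Q.obj n b) : markedBefore i hi hk hc X y ∈ markedFamily Q k c := fun t ht => by
  rw [markedBefore_apply]
  split_ifs
  · rw [hX t (by omega), map_zero, AddMonoidHom.zero_apply, smul_zero]
  · rfl

theorem markedAfter_mem {X : ℕ → Q.obj (m + 1) (a + 1)} (hX : X ∈ markedFamily Q m a)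
    (y : Q.obj n b) : markedAfter i hi hk hc X y ∈ markedFamily Q k c := fun t ht => by
  rw [markedAfter_apply, hX (t + 1 - n) (by omega), map_zero, AddMonoidHom.zero_apply, smul_zero,
    ite_self]

theorem markedInside_mem (x : Q.obj m a) (Y : ℕ → Q.obj (n + 1) (b + 1)) :
    markedInside i hi hk hc x Y ∈ markedFamily Q k c := fun t ht => by
  rw [markedInside_apply, if_neg (by omega)]

end Membership

/-- The square-zero extension of an operad by the operations with a marked input. -/
def markedExtension : GrOperad.{u} where
  obj n a := Q.obj n a × markedFamily Q n a
  one := (Q.one, 0)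
  comp i hi hk hc := AddMonoidHom.mk' (fun x => AddMonoidHom.mk'
      (fun y => (Q.comp i hi hk hc x.1 y.1,
        ⟨markedBefore i hi hk hc x.2.1 y.1 + markedAfter i hi hk hc x.2.1 y.1 +
            markedInside i hi hk hc x.1 y.2.1,
          add_mem (add_mem (markedBefore_mem i hi hk hc x.2.2 y.1)
            (markedAfter_mem i hi hk hc x.2.2 y.1)) (markedInside_mem i hi hk hc x.1 y.2.1)⟩))
      (by
        intro y y'
        refine Prod.ext (map_add _ _ _) (Subtype.ext ?_)
        simp only [Prod.fst_add, Prod.snd_add, AddSubgroup.coe_add, map_add]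
        abel))
    (by
      intro x x'
      ext y : 1
      refine Prod.ext (DFunLike.congr_fun (map_add (Q.comp i hi hk hc) x.1 x'.1) y.1)
        (Subtype.ext ?_)
      simp only [Prod.fst_add, Prod.snd_add, AddSubgroup.coe_add, map_add,
        AddMonoidHom.mk'_apply, AddMonoidHom.add_apply]
      abel)
  one_comp := by
    rintro n b ⟨y, Y⟩
    refine Prod.ext (Q.one_comp y) (Subtype.ext (funext fun t => ?_))
    simp only [AddMonoidHom.mk'_apply, AddSubgroup.coe_zero, map_zero,
      AddMonoidHom.zero_apply, zero_add, markedInside_apply]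
    split_ifs with h
    · exact Q.one_comp _
    · exact (Y.2 t (by omega)).symm
  comp_one := by
    rintro m a i hi ⟨x, X⟩
    refine Prod.ext (Q.comp_one i hi x) (Subtype.ext (funext fun t => ?_))
    simp only [AddMonoidHom.mk'_apply, Pi.add_apply, AddSubgroup.coe_zero, map_zero,
      add_zero, markedBefore_apply, markedAfter_apply, ksign_of_even Even.zero,
      one_smul, Nat.add_sub_cancel]
    by_cases h : t ≤ i
    · rw [if_pos h, if_neg (by omega), add_zero]
      exact Q.comp_one _ _ _
    · rw [if_neg h, if_pos (by omega), zero_add]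
      exact Q.comp_one _ _ _
  comp_assoc := by
    rintro m n p k l r a b c e f g i j hi hj hij hk hr hl hr' he hg hf hg' ⟨x, X⟩ ⟨y, Y⟩ ⟨z, Z⟩
    refine Prod.ext (Q.comp_assoc i j hi hj hij hk hr hl hr' he hg hf hg' x y z)
      (Subtype.ext ?_)
    simp only [AddMonoidHom.mk'_apply, map_add, AddMonoidHom.add_apply]
    rw [markedBefore_markedBefore_assoc hi hj hij hk hr hl hr' he hg hf hg',
      markedBefore_markedAfter_eq_zero hi hij hk hr he hg (by omega),
      markedBefore_markedInside_assoc hi hj hij hk hr hl hr' he hg hf hg',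
      markedAfter_markedBefore_eq_zero hi hij hk hr he hg (by omega),
      markedAfter_markedAfter_assoc hi hj hij hk hr hl hr' he hg hf hg',
      markedAfter_markedInside_assoc hi hj hij hk hr hl hr' he hg hf hg',
      markedInside_assoc hi hj hij hk hr hl hr' he hg hf hg']
    simp only [add_zero, zero_add]
    abel
  comp_parallel := by
    rintro m n p k l r a b c e f g i j j' hij hi hj hj' hjk hil hk hr hl hr' he hg hf hg'
      ⟨x, X⟩ ⟨y, Y⟩ ⟨z, Z⟩
    refine Prod.ext (Q.comp_parallel i j j' hij hi hj hj' hjk hil hk hr hl hr' he hg hf hg' x y z)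
      (Subtype.ext ?_)
    simp only [AddMonoidHom.mk'_apply, map_add, AddMonoidHom.add_apply, Prod.smul_snd,
      AddSubgroup.coe_zsmul, smul_add]
    rw [markedBefore_markedBefore_parallel hij hi hj hj' hjk hil hk hr hl hr' he hg hf hg',
      markedBefore_markedAfter_parallel hij hi hj hj' hjk hil hk hr hl hr' he hg hf hg',
      markedBefore_markedInside_parallel hij hi hj hj' hjk hil hk hr hl hr' he hg hf hg',
      markedAfter_markedBefore_eq_zero hi hjk hk hr he hg (by omega),
      markedAfter_markedAfter_parallel hij hi hj hj' hjk hil hk hr hl hr' he hg hf hg',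
      markedAfter_markedInside_eq_zero hi hjk hk hr he hg (by omega),
      markedInside_parallel hij hi hj hj' hjk hil hk hr hl hr' he hg hf hg',
      markedBefore_markedAfter_eq_zero hj hil hl hr' hf hg' (by omega),
      markedBefore_markedInside_eq_zero hj hil hl hr' hf hg' hij]
    simp only [smul_zero, add_zero, zero_add]
    abel

/-- The projection of the square-zero extension onto the operad. -/
def markedExtension.fst : GrOperad.Hom (markedExtension Q) Q where
  map := AddMonoidHom.fst _ _
  map_one := rfl
  map_comp _ _ _ _ _ _ := rfl

/-- The section of the square-zero extension. -/
def markedExtension.inl : GrOperad.Hom Q (markedExtension Q) where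
  map := AddMonoidHom.inl _ _
  map_one := rfl
  map_comp i hi hk hc x y := Prod.ext rfl <| Subtype.ext <| by
    change 0 = markedBefore i hi hk hc 0 y + markedAfter i hi hk hc 0 y +
      markedInside i hi hk hc x 0
    simp only [map_zero, AddMonoidHom.zero_apply, add_zero]

end MarkedExtension

/-! ### The derivative with respect to `κ` -/

/-- The identity operation, in a degree equal to zero. -/
def GrOperad.unit (Q : GrOperad.{u}) {b : ℤ} (hb : 0 = b) : Q.obj 1 b := hb ▸ Q.one

theorem GrOperad.comp_unit (Q : GrOperad.{u}) {m : ℕ} {a b : ℤ} (hb : 0 = b) (i : ℕ) (hi : i < m)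
    (hc : a + b = a) (x : Q.obj m a) : Q.comp i hi rfl hc x (Q.unit hb) = x := by
  subst hb
  exact Q.comp_one i hi x

section MarkedDerivation

variable {Q : GrOperad.{u}} {κ : Q.obj 0 (-1)} {Q₀ : SubOperad Q}

theorem exists_hom_of_isColimit
    (hQ : Limits.IsColimit (Limits.BinaryCofan.mk Q₀.incl (kappaHom Q κ))) {R : GrOperad.{u}}
    (f : Q₀.toOperad ⟶ R) (k : R.obj 0 (-1)) :
    ∃ F : GrOperad.Hom Q R,
      (∀ {n : ℕ} {a : ℤ} (x : Q₀.toOperad.obj n a), F.map x.1 = f.map x) ∧ F.map κ = k := by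
  obtain ⟨F, hf, hk⟩ := Limits.BinaryCofan.IsColimit.desc' hQ f (kappaHom R k)
  exact ⟨F, fun x => congrArg (fun G : GrOperad.Hom Q₀.toOperad R => G.map x) hf,
    congrArg (fun G : GrOperad.Hom kappaOperad R => G.map (FreeOperad.gen KGen.kappa)) hk⟩

theorem hom_ext_of_isColimit
    (hQ : Limits.IsColimit (Limits.BinaryCofan.mk Q₀.incl (kappaHom Q κ))) {R : GrOperad.{u}}
    {F G : Q ⟶ R} (h : Q₀.incl ≫ F = Q₀.incl ≫ G) (hκ : F.map κ = G.map κ) : F = G :=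
  Limits.BinaryCofan.IsColimit.hom_ext hQ h <| FreeOperad.hom_ext fun x => by cases x; exact hκ

/-- Derivations that vanish on `Q₀` and replace the occurrences of `κ`, one at a time, by a marked
input: the derivative with respect to `κ`. -/
structure IsMarkedDerivation (κ : Q.obj 0 (-1)) (Q₀ : SubOperad Q)
    (D : ∀ {n : ℕ} {a : ℤ}, Q.obj n a →+ (ℕ → Q.obj (n + 1) (a + 1))) : Prop where
  map_eq_zero : ∀ {n : ℕ} {a : ℤ} {x : Q.obj n a}, x ∈ Q₀.carrier n a → D x = 0
  map_kappa : D κ 0 = Q.unit (neg_add_cancel 1).symm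
  map_comp : ∀ {m n k : ℕ} {a b c : ℤ} (i : ℕ) (hi : i < m) (hk : m + n = k + 1) (hc : a + b = c)
    (x : Q.obj m a) (y : Q.obj n b), D (Q.comp i hi hk hc x y) =
      markedBefore i hi hk hc (D x) y + markedAfter i hi hk hc (D x) y +
        markedInside i hi hk hc x (D y)

theorem exists_isMarkedDerivation
    (hQ : Limits.IsColimit (Limits.BinaryCofan.mk Q₀.incl (kappaHom Q κ))) :
    ∃ D : ∀ {n : ℕ} {a : ℤ}, Q.obj n a →+ (ℕ → Q.obj (n + 1) (a + 1)),
      IsMarkedDerivation κ Q₀ D := by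
  let κ' : markedFamily Q 0 (-1) :=
    ⟨fun t => if t = 0 then Q.unit (neg_add_cancel 1).symm else 0, fun t ht => if_neg ht.ne'⟩
  obtain ⟨F, hF, hκ⟩ := exists_hom_of_isColimit (R := markedExtension Q) hQ
    (Q₀.incl ≫ markedExtension.inl Q) (κ, κ')
  have hfst : F ≫ markedExtension.fst Q = 𝟙 Q :=
    hom_ext_of_isColimit hQ (GrOperad.Hom.ext_apply fun x => congrArg Prod.fst (hF x))
      (congrArg Prod.fst hκ)
  have fst_map {n : ℕ} {a : ℤ} (x : Q.obj n a) : (F.map x).1 = x :=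
    congrArg (fun G : GrOperad.Hom Q Q => G.map x) hfst
  refine ⟨fun {n a} => (markedFamily Q n a).subtype.comp ((AddMonoidHom.snd _ _).comp F.map),
    fun {n a x} hx => congrArg (fun z => z.2.1) (hF ⟨x, hx⟩), congrArg (fun z => z.2.1 0) hκ,
    fun i hi hk hc x y => (congrArg (fun z => z.2.1) (F.map_comp i hi hk hc x y)).trans ?_⟩
  change markedBefore i hi hk hc _ (F.map y).1 + markedAfter i hi hk hc _ (F.map y).1 +
    markedInside i hi hk hc (F.map x).1 _ = _
  rw [fst_map, fst_map]
  rfl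

variable {D : ∀ {n : ℕ} {a : ℤ}, Q.obj n a →+ (ℕ → Q.obj (n + 1) (a + 1))}

theorem IsMarkedDerivation.map_comp_kappa (hD : IsMarkedDerivation κ Q₀ D) {n i : ℕ} {a b : ℤ}
    (hi : i < n + 1) (hb : a + -1 = b) (x : Q.obj (n + 1) a) (t : ℕ) :
    D (Q.comp i hi (add_zero (n + 1)) hb x κ) t =
      (if t ≤ i then -Q.comp (i + 1) (by omega) (add_zero (n + 2)) (by omega) (D x t) κ else 0) +
        (if i ≤ t then -Q.comp i (by omega) (add_zero (n + 2)) (by omega) (D x (t + 1)) κ else 0) +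
      if t = i then Q.comp i hi rfl (by omega) x (Q.unit (b := -1 + 1) (by omega)) else 0 := by
  rw [hD.map_comp, Pi.add_apply, Pi.add_apply, markedBefore_apply, markedAfter_apply,
    markedInside_apply, ksign_neg_one]
  simp only [neg_smul, one_smul, add_zero, tsub_zero, and_comm (a := i ≤ t), ← le_antisymm_iff]
  congr 1
  split_ifs with h
  · subst h
    simp only [Nat.sub_self, hD.map_kappa]
  · rfl

end MarkedDerivation

/-! ### Insertions of `κ` -/

section Insertion

variable {Q R : GrOperad.{u}}

/-- The sum of the insertions of `κ` into the inputs of an operation. -/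
def insertSum (κ : Q.obj 0 (-1)) {n : ℕ} {a b : ℤ} (h : a + -1 = b) :
    Q.obj (n + 1) a →+ Q.obj n b :=
  ∑ p : Fin (n + 1), (Q.comp p p.2 (add_zero (n + 1)) h).flip κ

theorem insertSum_apply (κ : Q.obj 0 (-1)) {n : ℕ} {a b : ℤ} (h : a + -1 = b)
    (x : Q.obj (n + 1) a) :
    insertSum κ h x = ∑ p : Fin (n + 1), Q.comp p p.2 (add_zero (n + 1)) h x κ :=
  AddMonoidHom.finsetSum_apply _ _ _

theorem map_insertSum (f : GrOperad.Hom Q R) (κ : Q.obj 0 (-1)) {n : ℕ} {a b : ℤ}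
    (h : a + -1 = b) (x : Q.obj (n + 1) a) :
    f.map (insertSum κ h x) = insertSum (f.map κ) h (f.map x) := by
  simp only [insertSum_apply, map_sum, f.map_comp]

variable (κ : Q.obj 0 (-1)) (Q₀ : SubOperad Q)

/-- The span of the operations of `Q₀` with one input filled by `κ`. -/
def kappaSpan (n : ℕ) (b : ℤ) : AddSubgroup (Q.obj n b) :=
  AddSubgroup.closure {x | ∃ (i : ℕ) (hi : i < n + 1), ∃ y ∈ Q₀.carrier (n + 1) (b + 1),
    Q.comp i hi (add_zero (n + 1)) (add_neg_cancel_right b 1) y κ = x}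

variable {κ Q₀}

theorem comp_kappa_mem_kappaSpan {m n : ℕ} {a b : ℤ} (i : ℕ) (hi : i < m) (hk : m + 0 = n + 1)
    (hb : a + -1 = b) {x : Q.obj m a} (hx : x ∈ Q₀.carrier m a) :
    Q.comp i hi hk hb x κ ∈ kappaSpan κ Q₀ n b := by
  obtain rfl : m = n + 1 := hk
  obtain rfl : a = b + 1 := by omega
  exact AddSubgroup.subset_closure ⟨i, hi, x, hx, rfl⟩

theorem comp_mem_kappaSpan_right {m n k : ℕ} {a b c : ℤ} (i : ℕ) (hi : i < m) (hk : m + n = k + 1)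
    (hc : a + b = c) {x : Q.obj m a} (hx : x ∈ Q₀.carrier m a) {y : Q.obj n b}
    (hy : y ∈ kappaSpan κ Q₀ n b) : Q.comp i hi hk hc x y ∈ kappaSpan κ Q₀ k c := by
  induction hy using AddSubgroup.closure_induction with
  | mem _ h =>
    obtain ⟨j, hj, y, hy, rfl⟩ := h
    rw [← Q.comp_assoc (k := k + 1) (e := c + 1) i j hi hj (by omega) (by omega) (by omega)
      (by omega) (by omega) (by omega) (by omega) (by omega) (by omega)]
    exact comp_kappa_mem_kappaSpan _ _ _ _ (Q₀.comp_mem _ _ _ _ hx hy)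
  | zero => simpa only [map_zero] using zero_mem _
  | add _ _ _ _ h h' => simpa only [map_add] using add_mem h h'
  | neg _ _ h => simpa only [map_neg] using neg_mem h

theorem comp_mem_kappaSpan_left {m n k : ℕ} {a b c : ℤ} (i : ℕ) (hi : i < m) (hk : m + n = k + 1)
    (hc : a + b = c) {x : Q.obj m a} (hx : x ∈ kappaSpan κ Q₀ m a) {y : Q.obj n b}
    (hy : y ∈ Q₀.carrier n b) : Q.comp i hi hk hc x y ∈ kappaSpan κ Q₀ k c := by
  induction hx using AddSubgroup.closure_induction with
  | mem _ h =>
    obtain ⟨j, hj, x, hx, rfl⟩ := h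
    rcases le_or_gt j i with hij | hij
    · rw [Q.comp_parallel (l := k + 1) (f := c + 1) j (i + 1) i (by omega) (by omega) (by omega)
        (by omega) (by omega) (by omega) (by omega) (by omega) (by omega) (by omega) (by omega)
        (by omega) (by omega) (by omega)]
      exact zsmul_mem (comp_kappa_mem_kappaSpan _ _ _ _ (Q₀.comp_mem _ _ _ _ hx hy)) _
    · have h := Q.smul_comp_parallel (l := m) (k := k + 1) (e := c + 1) i j (j + n - 1)
        (ksign_mul_self (b * -1)) hij (by omega) hj (by omega) (by omega) hi (by omega)
        (add_zero (k + 1)) (add_zero (m + 1)) hk (by omega) (by omega) (by omega) hc x y κ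
      rw [one_smul] at h
      rw [← h]
      exact zsmul_mem (comp_kappa_mem_kappaSpan _ _ _ _ (Q₀.comp_mem _ _ _ _ hx hy)) _
  | zero => simpa only [map_zero, AddMonoidHom.zero_apply] using zero_mem _
  | add _ _ _ _ h h' => simpa only [map_add, AddMonoidHom.add_apply] using add_mem h h'
  | neg _ _ h => simpa only [map_neg, AddMonoidHom.neg_apply] using neg_mem h

theorem IsMonomial.mem_of_eq_zero {w n : ℕ} {a : ℤ} {x : Q.obj n a} (h : IsMonomial κ Q₀ w x)
    (hw : w = 0) : x ∈ Q₀.carrier n a := by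
  induction h with
  | base hx => exact hx
  | kappa => exact absurd hw one_ne_zero
  | comp i hi hk hc _ _ ihx ihy =>
    exact Q₀.comp_mem i hi hk hc (ihx (by omega)) (ihy (by omega))

theorem IsMonomial.mem_kappaSpan {w n : ℕ} {a : ℤ} {x : Q.obj n a} (h : IsMonomial κ Q₀ w x)
    (hw : w = 1) : x ∈ kappaSpan κ Q₀ n a := by
  induction h with
  | base => exact absurd hw zero_ne_one
  | kappa =>
    simpa only [Q.one_comp] using
      comp_kappa_mem_kappaSpan (κ := κ) 0 Nat.one_pos rfl (zero_add (-1)) Q₀.one_mem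
  | @comp v w _ _ _ _ _ _ i hi hk hc _ _ hx hy ihx ihy =>
    rcases Nat.eq_zero_or_pos v with hv | hv
    · exact comp_mem_kappaSpan_right i hi hk hc (hx.mem_of_eq_zero hv) (ihy (by omega))
    · exact comp_mem_kappaSpan_left i hi hk hc (ihx (by omega)) (hy.mem_of_eq_zero (by omega))

theorem weightPart_zero (n : ℕ) (a : ℤ) : weightPart κ Q₀ 0 n a = Q₀.carrier n a :=
  le_antisymm ((AddSubgroup.closure_le _).mpr fun _ hx => IsMonomial.mem_of_eq_zero hx rfl)
    fun _ hx => AddSubgroup.subset_closure (IsMonomial.base hx)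

theorem kappa_mem_weightPart_one : κ ∈ weightPart κ Q₀ 1 0 (-1) :=
  AddSubgroup.subset_closure IsMonomial.kappa

theorem weightPart_one_le (n : ℕ) (a : ℤ) : weightPart κ Q₀ 1 n a ≤ kappaSpan κ Q₀ n a :=
  (AddSubgroup.closure_le _).mpr fun _ hx => IsMonomial.mem_kappaSpan hx rfl

theorem exists_eq_insertSum_of_mem_kappaSpan {a b : ℤ} (h : a + -1 = b) {x : Q.obj 0 b}
    (hx : x ∈ kappaSpan κ Q₀ 0 b) : ∃ y ∈ Q₀.carrier 1 a, insertSum κ h y = x := by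
  obtain rfl : a = b + 1 := by omega
  suffices hle : kappaSpan κ Q₀ 0 b ≤ (Q₀.carrier 1 (b + 1)).map (insertSum κ h) from hle hx
  refine (AddSubgroup.closure_le _).mpr ?_
  rintro _ ⟨i, hi, y, hy, rfl⟩
  obtain rfl : i = 0 := by omega
  exact ⟨y, hy, by rw [insertSum_apply, Fin.sum_univ_one]; rfl⟩

variable {D : ∀ {n : ℕ} {a : ℤ}, Q.obj n a →+ (ℕ → Q.obj (n + 1) (a + 1))}

theorem IsMarkedDerivation.map_comp_kappa_of_mem (hD : IsMarkedDerivation κ Q₀ D) {n i : ℕ} {b : ℤ}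
    (hi : i < n + 1) {x : Q.obj (n + 1) (b + 1)} (hx : x ∈ Q₀.carrier (n + 1) (b + 1)) (t : ℕ) :
    D (Q.comp i hi (add_zero (n + 1)) (add_neg_cancel_right b 1) x κ) t =
      if t = i then x else 0 := by
  rw [hD.map_comp_kappa, hD.map_eq_zero hx]
  simp only [Pi.zero_apply, map_zero, AddMonoidHom.zero_apply, neg_zero, ite_self, zero_add,
    GrOperad.comp_unit]

theorem IsMarkedDerivation.map_insertSum_zero (hD : IsMarkedDerivation κ Q₀ D) {n : ℕ} {b : ℤ}
    (x : Q.obj (n + 1) (b + 1)) :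
    D (insertSum κ (add_neg_cancel_right b 1) x) 0 =
      x - insertSum κ (add_neg_cancel_right (b + 1) 1) (D x 0) +
        Q.comp 0 (Nat.succ_pos _) (add_zero (n + 2)) (add_neg_cancel_right (b + 1) 1)
          (D x 0 - D x 1) κ := by
  have hp (p : Fin (n + 1)) :
      D (Q.comp p p.2 (add_zero (n + 1)) (add_neg_cancel_right b 1) x κ) 0 =
        -Q.comp (p + 1) (by omega) (add_zero (n + 2)) (add_neg_cancel_right (b + 1) 1) (D x 0) κ +
          if p = 0 then x - Q.comp 0 (Nat.succ_pos _) (add_zero (n + 2))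
            (add_neg_cancel_right (b + 1) 1) (D x 1) κ else 0 := by
    rw [hD.map_comp_kappa, if_pos p.val.zero_le, add_assoc]
    congr 1
    rcases eq_or_ne p 0 with rfl | hp
    · simp only [Fin.val_zero, le_refl, if_true, zero_add, GrOperad.comp_unit]
      exact neg_add_eq_sub _ _
    · have : (p : ℕ) ≠ 0 := Fin.val_ne_zero_iff.mpr hp
      rw [if_neg (by omega), if_neg this.symm, if_neg hp, add_zero]
  rw [insertSum_apply, insertSum_apply, map_sum, Finset.sum_apply,
    Finset.sum_congr rfl fun p _ => hp p, Finset.sum_add_distrib, Finset.sum_neg_distrib,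
    Finset.sum_ite_eq', if_pos (Finset.mem_univ _), Fin.sum_univ_succ (n := n + 1),
    map_sub, AddMonoidHom.sub_apply]
  simp only [Fin.val_zero, Fin.val_succ]
  abel

theorem eq_zero_of_insertSum_eq_zero
    (hQ : Limits.IsColimit (Limits.BinaryCofan.mk Q₀.incl (kappaHom Q κ))) {n : ℕ} {a b : ℤ}
    (h : a + -1 = b) {x : Q.obj (n + 1) a} (hx : x ∈ Q₀.carrier (n + 1) a)
    (hx₀ : insertSum κ h x = 0) : x = 0 := by
  obtain rfl : a = b + 1 := by omega
  obtain ⟨D, hD⟩ := exists_isMarkedDerivation hQ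
  have := hD.map_insertSum_zero x
  rw [hx₀, map_zero, hD.map_eq_zero hx] at this
  simpa only [Pi.zero_apply, map_zero, sub_zero, AddMonoidHom.zero_apply, add_zero] using this.symm

theorem IsMarkedDerivation.apply_mem (hD : IsMarkedDerivation κ Q₀ D) {n : ℕ} {b : ℤ}
    {x : Q.obj n b} (hx : x ∈ Q₀.carrier n b ⊔ kappaSpan κ Q₀ n b) (t : ℕ) :
    D x t ∈ Q₀.carrier (n + 1) (b + 1) := by
  let S := (Q₀.carrier (n + 1) (b + 1)).comap ((Pi.evalAddMonoidHom _ t).comp D)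
  suffices hle : Q₀.carrier n b ⊔ kappaSpan κ Q₀ n b ≤ S from hle hx
  refine sup_le (fun y hy => ?_) ((AddSubgroup.closure_le _).mpr ?_)
  · change D y t ∈ Q₀.carrier _ _
    rw [hD.map_eq_zero hy]
    exact zero_mem _
  · rintro _ ⟨i, hi, y, hy, rfl⟩
    change D _ t ∈ Q₀.carrier _ _
    rw [hD.map_comp_kappa_of_mem hi hy]
    split_ifs
    exacts [hy, zero_mem _]

theorem exists_eq_insertSum
    (hQ : Limits.IsColimit (Limits.BinaryCofan.mk Q₀.incl (kappaHom Q κ))) {n : ℕ} {a b c : ℤ}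
    (h : a + -1 = b) (h' : b + -1 = c) {x : Q.obj (n + 1) b}
    (hx : x ∈ Q₀.carrier (n + 1) b ⊔ kappaSpan κ Q₀ (n + 1) b) (hx₀ : insertSum κ h' x = 0) :
    ∃ y ∈ Q₀.carrier (n + 2) a, insertSum κ h y = x := by
  obtain rfl : b = c + 1 := by omega
  obtain rfl : a = c + 1 + 1 := by omega
  obtain ⟨D, hD⟩ := exists_isMarkedDerivation hQ
  have hDx (t : ℕ) := hD.apply_mem hx t
  have hxD : 0 = x - insertSum κ h (D x 0) +
      Q.comp 0 (Nat.succ_pos _) (add_zero (n + 2)) h (D x 0 - D x 1) κ := by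
    rw [← hD.map_insertSum_zero, hx₀, map_zero, Pi.zero_apply]
  have hDD : D x 0 - D x 1 = 0 := by
    have h₀ := congrFun (congrArg D hxD) 0
    rw [map_add, map_sub, Pi.add_apply, Pi.sub_apply, hD.map_insertSum_zero, hD.map_eq_zero (hDx 0),
      hD.map_comp_kappa_of_mem _ (sub_mem (hDx 0) (hDx 1)), if_pos rfl] at h₀
    simpa only [map_zero, Pi.zero_apply, sub_zero, sub_self, AddMonoidHom.zero_apply, add_zero,
      zero_add] using h₀.symm
  refine ⟨D x 0, hDx 0, (sub_eq_zero.mp ?_).symm⟩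
  rw [hxD, hDD, map_zero, AddMonoidHom.zero_apply, add_zero]

end Insertion

/-! ### The curved A-infinity equations -/

section CurvedFamilies

variable {P Q : GrOperad.{u}}

/-- The part of `∑_{p+q+r=n} m_{p+1+r} ∘_{p+1} m_q` with `q > 0`; the index `q` is shifted by
one. -/
def posSum (m : ∀ n, Q.obj n (-1)) (n : ℕ) : Q.obj n (-2) :=
  ∑ q : Fin n, ∑ p : Fin (n + 1 - (q + 1)),
    Q.comp p p.2 (by omega) (by omega) (m (n + 1 - (q + 1))) (m (q + 1))

theorem map_posSum (f : GrOperad.Hom P Q) (m : ∀ n, P.obj n (-1)) (n : ℕ) :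
    f.map (posSum m n) = posSum (fun k => f.map (m k)) n := by
  simp only [posSum, map_sum, f.map_comp]

theorem posSum_congr {m m' : ∀ n, Q.obj n (-1)} {n : ℕ} (h : ∀ k ≤ n, m k = m' k) :
    posSum m n = posSum m' n :=
  Finset.sum_congr rfl fun q _ => Finset.sum_congr rfl fun p _ => by
    rw [h _ (by omega), h _ (by omega)]

theorem posSum_mem {Q₀ : SubOperad Q} {m : ∀ n, Q.obj n (-1)}
    (h : ∀ k, 0 < k → m k ∈ Q₀.carrier k (-1)) (n : ℕ) : posSum m n ∈ Q₀.carrier n (-2) :=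
  sum_mem fun q _ => sum_mem fun p _ =>
    Q₀.comp_mem _ _ _ _ (h _ (by omega)) (h _ (Nat.succ_pos _))

/-- The operations `μ_n`, typed as operations of `cAInf`. -/
def caMu (n : ℕ) : cAInf.{u}.obj n (-1) := mu n

theorem cAInf_d_caMu (n : ℕ) :
    cAInf.{u}.d (b := -2) (by rfl) (caMu n) =
      -(insertSum (caMu 0) (b := -2) (by rfl) (caMu (n + 1)) + posSum caMu n) := by
  rw [insertSum_apply]
  exact congrArg Neg.neg (Fin.sum_univ_succ _)

/-- The morphism of graded operads that sends `μ_n` to `m n`. -/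
def evalMu (m : ∀ n, Q.obj n (-1)) : GrOperad.Hom cAInf.{u}.toGrOperad Q :=
  FreeOperad.lift Q fun {n a} x => match n, a, x with | _, _, .mu n => m n

theorem hom_eq_evalMu (f : GrOperad.Hom cAInf.{u}.toGrOperad Q) :
    f = evalMu fun n => f.map (caMu n) :=
  FreeOperad.hom_ext fun | .mu _ => rfl

theorem derivDefect_insertSum (f : GrOperad.Hom P Q) {D : P.LowerMap} {D' : Q.LowerMap}
    (hD : IsDerivation D) (hD' : IsDerivation D') {κ : P.obj 0 (-1)}
    (hκ : derivDefect f D D' (b := -2) (by rfl) κ = 0) {n : ℕ} {a b a' b' : ℤ} (h : a + -1 = b)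
    (ha : a' + 1 = a) (hb : b' + 1 = b) (h' : a' + -1 = b') (x : P.obj (n + 1) a) :
    derivDefect f D D' hb (insertSum κ h x) = insertSum (f.map κ) h' (derivDefect f D D' ha x) := by
  rw [insertSum_apply, insertSum_apply, map_sum]
  refine Finset.sum_congr rfl fun p _ => ?_
  rw [derivDefect_comp f hD hD' (b' := -2) p p.2 _ h ha (by rfl) hb h' (by omega), hκ, map_zero,
    smul_zero, add_zero]

end CurvedFamilies

section Defect

variable {Q : DGOperad.{u}}

/-- The failure of the curved A-infinity equation of arity `n` for the operations `m`. -/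
def defect (m : ∀ n, Q.obj n (-1)) (n : ℕ) : Q.obj n (-2) :=
  Q.d (b := -2) (by rfl) (m n) + (insertSum (m 0) (b := -2) (by rfl) (m (n + 1)) + posSum m n)

theorem defect_congr {m m' : ∀ n, Q.obj n (-1)} {n : ℕ} (h : ∀ k ≤ n + 1, m k = m' k) :
    defect m n = defect m' n := by
  rw [defect, defect, h n n.le_succ, h (n + 1) le_rfl, h 0 (Nat.zero_le _),
    posSum_congr fun k hk => h k (by omega)]

theorem derivDefect_evalMu (m : ∀ n, Q.obj n (-1)) (n : ℕ) :
    derivDefect (evalMu m) cAInf.d Q.d (b := -2) (by rfl) (caMu n) = defect m n := by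
  change Q.d _ (m n) - (evalMu m).map (cAInf.d _ (caMu n)) = _
  rw [cAInf_d_caMu, map_neg, sub_neg_eq_add, map_add, map_insertSum, map_posSum]
  rfl

theorem evalMu_d {m : ∀ n, Q.obj n (-1)} (hm : ∀ n, defect m n = 0) {n : ℕ} {a b : ℤ}
    (h : b + 1 = a) (x : cAInf.obj n a) :
    (evalMu m).map (cAInf.d h x) = Q.d h ((evalMu m).map x) := by
  refine (sub_eq_zero.mp
    (FreeOperad.derivDefect_eq_zero cAInf.d_comp Q.d_comp (evalMu m) ?_ h x)).symm
  rintro k _ b h ⟨⟩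
  obtain rfl : b = -2 := by omega
  exact (derivDefect_evalMu m k).trans (hm k)

/-- This follows from `d² = 0`: the morphism `evalMu m` commutes with the differentials on all the
terms of `d μ_n`, except for those that involve `μ_{n+1}`. -/
theorem insertSum_defect {m : ∀ n, Q.obj n (-1)} {n : ℕ} (hm : ∀ q ≤ n, defect m q = 0) :
    insertSum (m 0) (b := -3) (by rfl) (defect m (n + 1)) = 0 := by
  have hE (q : ℕ) (hq : q ≤ n) :
      derivDefect (evalMu m) cAInf.d Q.d (b := -2) (by rfl) (caMu q) = 0 :=
    (derivDefect_evalMu m q).trans (hm q hq)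
  have hd : derivDefect (evalMu m) cAInf.d Q.d (b := -3) (by rfl)
      (cAInf.d (b := -2) (by rfl) (caMu n)) = 0 := by
    have hEd : (evalMu m).map (cAInf.d (b := -2) (by rfl) (caMu n)) = Q.d _ (m n) :=
      (sub_eq_zero.mp (hE n le_rfl)).symm
    change Q.d _ ((evalMu m).map _) - (evalMu m).map (cAInf.d _ (cAInf.d _ _)) = 0
    rw [hEd, Q.d_d, cAInf.d_d, map_zero, sub_zero]
  have hpos : derivDefect (evalMu m) cAInf.d Q.d (b := -3) (by rfl) (posSum caMu n) = 0 := by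
    simp only [posSum, map_sum]
    refine Finset.sum_eq_zero fun q _ => Finset.sum_eq_zero fun p _ => ?_
    rw [derivDefect_comp (evalMu m) cAInf.d_comp Q.d_comp (a' := -2) (b' := -2) p p.2 _ _ (by rfl)
      (by rfl) (by rfl) (by rfl) (by rfl),
      hE _ (by omega), hE _ (by omega), map_zero, map_zero, smul_zero, AddMonoidHom.zero_apply,
      add_zero]
  rw [cAInf_d_caMu, map_neg, map_add, hpos, add_zero, neg_eq_zero] at hd
  rw [← hd, ← derivDefect_evalMu]
  exact (derivDefect_insertSum (evalMu m) cAInf.d_comp Q.d_comp (hE 0 n.zero_le) _ _ _ _ _).symm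

end Defect

/-! ### Families of operations in a curved operad -/

section Curved

variable {Q : DGOperad.{u}} {κ : Q.obj 0 (-1)} {Q₀ : SubOperad Q.toGrOperad}

theorem IsCurved.d_mem (hQ : IsCurved Q κ Q₀) {n : ℕ} {a b : ℤ} (h : b + 1 = a) {x : Q.obj n a}
    (hx : x ∈ Q₀.carrier n a) : Q.d h x ∈ Q₀.carrier n b ⊔ kappaSpan κ Q₀ n b := by
  obtain ⟨d₀, d₁, hd, h₀, h₁, -⟩ := hQ.strictMixed
  have hw : x ∈ weightPart κ Q₀ 0 n a := (weightPart_zero n a).ge hx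
  rw [hd]
  exact AddSubgroup.add_mem_sup ((weightPart_zero n b).le (h₀ h 0 x hw))
    (weightPart_one_le n b (h₁ h 0 x hw))

theorem IsCurved.d_kappa_mem (hQ : IsCurved Q κ Q₀) {b : ℤ} (h : b + 1 = -1) :
    Q.d h κ ∈ kappaSpan κ Q₀ 0 b := by
  obtain ⟨d₀, d₁, hd, h₀, -, hκ⟩ := hQ.strictMixed
  rw [hd, hκ, add_zero]
  exact weightPart_one_le 0 b (h₀ h 1 κ kappa_mem_weightPart_one)

/-- Families of operations that can serve as images of the `μ_n` under a morphism of `Curv`, as far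
as the values in arities less than `N` of the differential are concerned. -/
structure IsCurvedFamily (κ : Q.obj 0 (-1)) (Q₀ : SubOperad Q.toGrOperad)
    (m : ∀ n, Q.obj n (-1)) (N : ℕ) : Prop where
  apply_zero : m 0 = κ
  mem : ∀ k, 0 < k → m k ∈ Q₀.carrier k (-1)
  defect_eq_zero : ∀ q < N, defect m q = 0

variable {m m' : ∀ n, Q.obj n (-1)} {N : ℕ}

theorem IsCurvedFamily.mono (hm : IsCurvedFamily κ Q₀ m N) {M : ℕ} (h : M ≤ N) :
    IsCurvedFamily κ Q₀ m M :=
  ⟨hm.apply_zero, hm.mem, fun q hq => hm.defect_eq_zero q (hq.trans_le h)⟩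

theorem IsCurvedFamily.apply_eq (hQ : IsCurved Q κ Q₀) (hm : IsCurvedFamily κ Q₀ m N)
    (hm' : IsCurvedFamily κ Q₀ m' N) {k : ℕ} (hk : k ≤ N) : m k = m' k := by
  obtain ⟨hcol⟩ := hQ.isCoproduct
  induction k using Nat.strong_induction_on with
  | _ k ih =>
    rcases k with _ | k
    · rw [hm.apply_zero, hm'.apply_zero]
    · have h := (hm.defect_eq_zero k hk).trans (hm'.defect_eq_zero k hk).symm
      rw [defect, defect, ih k k.lt_succ_self (by omega),
        posSum_congr fun j hj => ih j (by omega) (by omega), add_right_inj, add_left_inj,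
        hm.apply_zero, hm'.apply_zero, ← sub_eq_zero, ← map_sub] at h
      exact sub_eq_zero.mp (eq_zero_of_insertSum_eq_zero hcol _
        (sub_mem (hm.mem _ k.succ_pos) (hm'.mem _ k.succ_pos)) h)

theorem IsCurvedFamily.exists_insertSum_eq_defect (hQ : IsCurved Q κ Q₀)
    (hm : IsCurvedFamily κ Q₀ m N) :
    ∃ y ∈ Q₀.carrier (N + 1) (-1), insertSum κ (by rfl) y = defect m N := by
  have hins : insertSum (m 0) (by rfl) (m (N + 1)) ∈ kappaSpan κ Q₀ N (-2) := by
    rw [hm.apply_zero, insertSum_apply]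
    exact sum_mem fun p _ => comp_kappa_mem_kappaSpan p p.2 _ _ (hm.mem _ N.succ_pos)
  rcases N with _ | N
  · refine exists_eq_insertSum_of_mem_kappaSpan _ (add_mem ?_ (add_mem hins ?_))
    · rw [hm.apply_zero]
      exact hQ.d_kappa_mem _
    · exact zero_mem _
  · obtain ⟨hcol⟩ := hQ.isCoproduct
    refine exists_eq_insertSum hcol _ (c := -3) (by rfl) (add_mem ?_ (add_mem ?_ ?_)) ?_
    · exact hQ.d_mem _ (hm.mem _ N.succ_pos)
    · exact AddSubgroup.mem_sup_right hins
    · exact AddSubgroup.mem_sup_left (posSum_mem hm.mem _)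
    · rw [← hm.apply_zero]
      exact insertSum_defect fun q hq => hm.defect_eq_zero q (by omega)

theorem exists_isCurvedFamily (hQ : IsCurved Q κ Q₀) (N : ℕ) :
    ∃ m : ∀ n, Q.obj n (-1), IsCurvedFamily κ Q₀ m N := by
  induction N with
  | zero =>
    refine ⟨Function.update 0 0 κ, Function.update_self .., fun k hk => ?_, by simp⟩
    rw [Function.update_of_ne hk.ne']
    exact zero_mem _
  | succ N ih =>
    obtain ⟨m, hm⟩ := ih
    obtain ⟨y, hy, hyd⟩ := hm.exists_insertSum_eq_defect hQ
    let m' := Function.update m (N + 1) (m (N + 1) - y)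
    have hle (k : ℕ) (hk : k ≤ N) : m' k = m k := Function.update_of_ne (by omega) _ _
    refine ⟨m', (hle 0 N.zero_le).trans hm.apply_zero, fun k hk => ?_, fun q hq => ?_⟩
    · rcases eq_or_ne k (N + 1) with rfl | h
      · rw [show m' (N + 1) = _ from Function.update_self ..]
        exact sub_mem (hm.mem _ hk) hy
      · rw [show m' k = _ from Function.update_of_ne h _ _]
        exact hm.mem k hk
    · rcases Nat.lt_succ_iff_lt_or_eq.mp hq with h | rfl
      · rw [defect_congr fun k hk => hle k (by omega)]
        exact hm.defect_eq_zero q h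
      · rw [defect, hle q le_rfl, hle 0 q.zero_le, posSum_congr hle,
          show m' (q + 1) = _ from Function.update_self .., map_sub, sub_add_eq_add_sub,
          add_sub_assoc', ← defect, hm.apply_zero, hyd, sub_self]

theorem exists_forall_isCurvedFamily (hQ : IsCurved Q κ Q₀) :
    ∃ m : ∀ n, Q.obj n (-1), ∀ N, IsCurvedFamily κ Q₀ m N := by
  choose M hM using exists_isCurvedFamily hQ
  have hle {k N : ℕ} (hk : k ≤ N) : M k k = M N k :=
    (hM k).apply_eq hQ ((hM N).mono hk) le_rfl
  refine ⟨fun k => M k k, fun N => ⟨(hM 0).apply_zero, fun k hk => (hM k).mem k hk, fun q _ => ?_⟩⟩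
  rw [defect_congr (m' := M (q + 1)) fun k hk => hle hk]
  exact (hM (q + 1)).defect_eq_zero q q.lt_succ_self

end Curved

/-! ### The curved A-infinity operad as an object of `Curv` -/

/-- The operad with the same group `A` in every arity and degree, and with the multiplication of
`A` as composition. Characteristic two makes the Koszul signs trivial. -/
def constOperad (A : Type u) [CommRing A] [CharP A 2] : GrOperad.{u} where
  obj _ _ := A
  one := 1
  comp _ _ _ _ := AddMonoidHom.mul
  one_comp := one_mul
  comp_one _ _ := mul_one
  comp_assoc _ _ _ _ _ _ _ _ _ _ _ _ _ _ _ _ := mul_assoc _ _ _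
  comp_parallel _ _ _ _ _ _ _ _ _ _ _ _ _ _ _ _ _ x y z := by
    have hsign (e : ℤ) (t : A) : ksign e • t = t := by
      rcases em (Even e) with he | he
      · rw [ksign_of_even he, one_smul]
      · rw [ksign_of_not_even he, neg_smul, one_smul, CharTwo.neg_eq]
    rw [hsign]
    exact mul_right_comm x y z

theorem caMu_ne_zero (n : ℕ) : caMu.{u} n ≠ 0 := by
  intro h
  let A := ULift.{u} (ZMod 2)
  have hone : (1 : A) = 0 :=
    (congrArg (evalMu (Q := constOperad A) fun _ => (1 : A)).map h).trans (map_zero _)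
  exact one_ne_zero hone

/-- The sub-operad of the operations with at least one input, together with the zeros. -/
def positiveArity (Q : GrOperad.{u}) : SubOperad Q where
  carrier n _ := if n = 0 then ⊥ else ⊤
  one_mem := by simp
  comp_mem := by
    intro m n k a b c i hi hk hc x y _ hy
    rcases eq_or_ne k 0 with hk₀ | hk₀
    · rw [if_pos (by omega), AddSubgroup.mem_bot] at hy
      rw [hy, map_zero]
      exact zero_mem _
    · simp [hk₀]

theorem caMu_mem_cAInfPos {n : ℕ} (hn : 0 < n) : caMu.{u} n ∈ cAInfPos.{u}.carrier n (-1) :=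
  SubOperad.subset_closure _ _ _ ⟨hn, CAGen.mu n, rfl⟩

theorem cAInfPos_le {S : SubOperad cAInf.{u}.toGrOperad}
    (h : ∀ n, 0 < n → caMu n ∈ S.carrier n (-1)) (n : ℕ) (a : ℤ) :
    cAInfPos.{u}.carrier n a ≤ S.carrier n a :=
  SubOperad.closure_le (by rintro n _ _ ⟨hn, ⟨_⟩, rfl⟩; exact h n hn) n a

theorem caMu_zero_notMem_cAInfPos : caMu.{u} 0 ∉ cAInfPos.{u}.carrier 0 (-1) := fun h =>
  caMu_ne_zero 0 (cAInfPos_le (S := positiveArity cAInf.toGrOperad)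
    (fun n hn => by simp [positiveArity, hn.ne']) 0 (-1) h)

theorem cAInf_isCoproduct : Nonempty (Limits.IsColimit
    (Limits.BinaryCofan.mk cAInfPos.{u}.incl (kappaHom cAInf.{u}.toGrOperad (caMu 0)))) := by
  let family {R : GrOperad.{u}} (f : GrOperad.Hom cAInfPos.{u}.toOperad R)
      (g : GrOperad.Hom kappaOperad R) : ∀ n, R.obj n (-1)
    | 0 => g.map (FreeOperad.gen KGen.kappa)
    | n + 1 => f.map ⟨caMu (n + 1), caMu_mem_cAInfPos n.succ_pos⟩
  refine ⟨Limits.BinaryCofan.IsColimit.mk _ (fun {R} f g => evalMu (family f g))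
    (fun {R} f g => ?_) (fun {R} f g => ?_) (fun {R} f g l hf hg => ?_)⟩
  · refine SubOperad.closure_hom_ext ?_
    rintro (_ | n) _ _ ⟨hn, ⟨_⟩, rfl⟩
    · exact absurd hn (lt_irrefl 0)
    · rfl
  · exact FreeOperad.hom_ext fun | .kappa => rfl
  · subst hf hg
    refine FreeOperad.hom_ext ?_
    rintro (_ | n) _ ⟨_⟩ <;> rfl

section Weight

variable {Q : GrOperad.{u}} {κ : Q.obj 0 (-1)} {Q₀ : SubOperad Q}

theorem comp_mem_weightPart {v w m n k : ℕ} {a b c : ℤ} (i : ℕ) (hi : i < m) (hk : m + n = k + 1)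
    (hc : a + b = c) {x : Q.obj m a} {y : Q.obj n b} (hx : x ∈ weightPart κ Q₀ v m a)
    (hy : y ∈ weightPart κ Q₀ w n b) : Q.comp i hi hk hc x y ∈ weightPart κ Q₀ (v + w) k c := by
  induction hx using AddSubgroup.closure_induction with
  | mem x hx =>
    induction hy using AddSubgroup.closure_induction with
    | mem y hy => exact AddSubgroup.subset_closure (IsMonomial.comp i hi hk hc hx hy)
    | zero => simpa only [map_zero] using zero_mem _
    | add _ _ _ _ h h' => simpa only [map_add] using add_mem h h'
    | neg _ _ h => simpa only [map_neg] using neg_mem h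
  | zero => simpa only [map_zero, AddMonoidHom.zero_apply] using zero_mem _
  | add _ _ _ _ h h' => simpa only [map_add, AddMonoidHom.add_apply] using add_mem h h'
  | neg _ _ h => simpa only [map_neg, AddMonoidHom.neg_apply] using neg_mem h

variable {D : Q.LowerMap}

/-- The sub-operad of the operations of `Q₀` that a derivation maps to operations of weight `s`. -/
def IsDerivation.weightLocus (hD : IsDerivation D) (κ : Q.obj 0 (-1)) (Q₀ : SubOperad Q) (s : ℕ) :
    SubOperad Q where
  carrier n a := Q₀.carrier n a ⊓ ⨅ b, ⨅ h : b + 1 = a, (weightPart κ Q₀ s n b).comap (D h)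
  one_mem := by
    simp only [AddSubgroup.mem_inf, AddSubgroup.mem_iInf, AddSubgroup.mem_comap, hD.map_one]
    exact ⟨Q₀.one_mem, fun _ _ => zero_mem _⟩
  comp_mem {m n k a b c} i hi hk hc x y hx hy := by
    simp only [AddSubgroup.mem_inf, AddSubgroup.mem_iInf, AddSubgroup.mem_comap] at hx hy ⊢
    refine ⟨Q₀.comp_mem i hi hk hc hx.1 hy.1, fun c' hc' => ?_⟩
    rw [hD (a' := a - 1) (b' := b - 1) i hi hk hc (by omega) (by omega) hc' (by omega) (by omega)]
    refine add_mem ?_ (zsmul_mem ?_ _)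
    · exact comp_mem_weightPart (v := s) (w := 0) i hi hk _ (hx.2 (a - 1) _)
        ((weightPart_zero _ _).ge hy.1)
    · simpa only [zero_add] using
        comp_mem_weightPart (v := 0) (w := s) i hi hk _
          ((weightPart_zero _ _).ge hx.1) (hy.2 (b - 1) _)

theorem IsDerivation.weightPart_le_comap (hD : IsDerivation D) {s : ℕ}
    (hQ₀ : ∀ {n : ℕ} {a b : ℤ} (h : b + 1 = a) (x : Q.obj n a), x ∈ Q₀.carrier n a →
      D h x ∈ weightPart κ Q₀ s n b)
    (hκ : ∀ {b : ℤ} (h : b + 1 = -1), D h κ ∈ weightPart κ Q₀ (1 + s) 0 b)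
    {w n : ℕ} {a b : ℤ} (h : b + 1 = a) :
    weightPart κ Q₀ w n a ≤ (weightPart κ Q₀ (w + s) n b).comap (D h) := by
  refine (AddSubgroup.closure_le _).mpr fun x hx => ?_
  change D h x ∈ weightPart κ Q₀ (w + s) n b
  induction hx generalizing b with
  | base hx => simpa only [zero_add] using hQ₀ h _ hx
  | kappa => exact hκ h
  | @comp v w m n k a a' c i hi hk hc x y hx hy ihx ihy =>
    rw [hD (a' := a - 1) (b' := a' - 1) i hi hk hc (by omega) (by omega) h (by omega) (by omega)]
    refine add_mem ?_ (zsmul_mem ?_ _)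
    · rw [add_right_comm]
      exact comp_mem_weightPart _ _ _ _ (ihx _) (AddSubgroup.subset_closure hy)
    · rw [add_assoc]
      exact comp_mem_weightPart _ _ _ _ (AddSubgroup.subset_closure hx) (ihy _)

end Weight

/-- The derivation of the free operad on the `μ_n` that sends `μ_n` to `y n`. -/
def muDeriv (y : ∀ n, cAInf.{u}.obj n (-2)) : cAInf.{u}.toGrOperad.LowerMap :=
  FreeObj.deriv fun {n a} x b hb => match n, a, x with
    | _, _, .mu n => (show -2 = b by omega) ▸ y n

theorem isDerivation_muDeriv (y : ∀ n, cAInf.{u}.obj n (-2)) : IsDerivation (muDeriv y) :=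
  isDerivation_deriv _

theorem muDeriv_caMu (y : ∀ n, cAInf.{u}.obj n (-2)) (n : ℕ) :
    muDeriv y (b := -2) (by rfl) (caMu n) = y n :=
  rfl

theorem IsDerivation.cAInf_ext {D D' : cAInf.{u}.toGrOperad.LowerMap} (hD : IsDerivation D)
    (hD' : IsDerivation D')
    (h : ∀ n, D (b := -2) (by rfl) (caMu n) = D' (b := -2) (by rfl) (caMu n)) {n : ℕ} {a b : ℤ}
    (hb : b + 1 = a) (x : cAInf.{u}.obj n a) : D hb x = D' hb x := by
  refine (sub_eq_zero.mp
    (FreeOperad.derivDefect_eq_zero hD hD' (𝟙 (FreeOperad CAGen)) ?_ hb x)).symm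
  rintro n _ b hb ⟨⟩
  obtain rfl : b = -2 := by omega
  exact sub_eq_zero.mpr (h n).symm

theorem muDeriv_mem_weightPart {y : ∀ n, cAInf.{u}.obj n (-2)} {s : ℕ}
    (hpos : ∀ n, y (n + 1) ∈ weightPart (Q := cAInf.toGrOperad) (caMu 0) cAInfPos s (n + 1) (-2))
    (hzero : y 0 ∈ weightPart (Q := cAInf.toGrOperad) (caMu 0) cAInfPos (1 + s) 0 (-2))
    {w n : ℕ} {a b : ℤ} (h : b + 1 = a) {x : cAInf.{u}.obj n a}
    (hx : x ∈ weightPart (Q := cAInf.toGrOperad) (caMu 0) cAInfPos w n a) :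
    muDeriv y h x ∈ weightPart (Q := cAInf.toGrOperad) (caMu 0) cAInfPos (w + s) n b := by
  have hD : IsDerivation (muDeriv y) := isDerivation_muDeriv y
  refine IsDerivation.weightPart_le_comap hD (fun {n a b} h x hx => ?_) (fun {b} h => ?_) h hx
  · have hx := cAInfPos_le (S := hD.weightLocus (caMu 0) cAInfPos s) (fun n hn => ?_) n a hx
    · simp only [IsDerivation.weightLocus, AddSubgroup.mem_inf, AddSubgroup.mem_iInf] at hx
      exact hx.2 b h
    · simp only [IsDerivation.weightLocus, AddSubgroup.mem_inf, AddSubgroup.mem_iInf]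
      refine ⟨caMu_mem_cAInfPos hn, fun b hb => ?_⟩
      obtain rfl : b = -2 := by omega
      obtain ⟨n, rfl⟩ := Nat.exists_eq_succ_of_ne_zero hn.ne'
      exact hpos n
  · obtain rfl : b = -2 := by omega
    exact hzero

/-- The part of `d` that preserves the weight, on the generators. -/
def muDiffZero : ∀ n, cAInf.{u}.obj n (-2)
  | 0 => -insertSum (caMu 0) (by rfl) (caMu 1)
  | n + 1 => -posSum caMu (n + 1)

/-- The part of `d` that raises the weight by one, on the generators. -/
def muDiffOne : ∀ n, cAInf.{u}.obj n (-2)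
  | 0 => 0
  | n + 1 => -insertSum (caMu 0) (by rfl) (caMu (n + 2))

theorem cAInf_d_eq_add {n : ℕ} {a b : ℤ} (h : b + 1 = a) (x : cAInf.{u}.obj n a) :
    cAInf.d h x = muDeriv muDiffZero h x + muDeriv muDiffOne h x := by
  refine IsDerivation.cAInf_ext cAInf.d_comp
    (IsDerivation.add (isDerivation_muDeriv _) (isDerivation_muDeriv _)) (fun n => ?_) h x
  rw [cAInf_d_caMu, AddMonoidHom.add_apply, muDeriv_caMu, muDeriv_caMu]
  rcases n with _ | n
  · simp [muDiffZero, muDiffOne, posSum]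
  · rw [muDiffZero, muDiffOne, neg_add_rev]

theorem neg_insertSum_caMu_mem_weightPart (n : ℕ) :
    -insertSum (caMu 0) (b := -2) (by rfl) (caMu (n + 1)) ∈
      weightPart (Q := cAInf.{u}.toGrOperad) (caMu 0) cAInfPos 1 n (-2) := by
  rw [insertSum_apply]
  exact neg_mem (sum_mem fun p _ => comp_mem_weightPart (v := 0) (w := 1) p p.2 _ _
    ((weightPart_zero _ _).ge (caMu_mem_cAInfPos n.succ_pos)) kappa_mem_weightPart_one)

theorem cAInf_isCurved : IsCurved cAInf.{u} (mu 0) cAInfPos where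
  kappa_notMem := caMu_zero_notMem_cAInfPos
  isCoproduct := cAInf_isCoproduct
  strictMixed := by
    refine ⟨muDeriv muDiffZero, muDeriv muDiffOne, cAInf_d_eq_add,
      fun h w x hx => ?_, fun h w x hx => ?_, fun h => ?_⟩
    · refine muDeriv_mem_weightPart (s := 0) (fun n => ?_) ?_ h hx
      · exact (weightPart_zero _ _).ge (neg_mem (posSum_mem (fun _ => caMu_mem_cAInfPos) _))
      · exact neg_insertSum_caMu_mem_weightPart 0
    · refine muDeriv_mem_weightPart (s := 1) (fun n => ?_) ?_ h hx
      · exact neg_insertSum_caMu_mem_weightPart (n + 1)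
      · exact zero_mem _
    · rename_i b
      obtain rfl : b = -2 := by omega
      rfl

/-! ### Initiality -/

/-- The object of `Curv` given by the curved A-infinity operad. -/
abbrev cAInfCurv : Curv.{u} :=
  ⟨cAInf, mu 0, cAInfPos, cAInf_isCurved⟩

theorem exists_curvHom (C : Curv.{u}) : Nonempty (cAInfCurv ⟶ C) := by
  obtain ⟨m, hm⟩ := exists_forall_isCurvedFamily C.isCurved
  exact ⟨{
    toGrHom := evalMu m
    map_d := evalMu_d fun n => (hm (n + 1)).defect_eq_zero n n.lt_succ_self
    map_kappa := (hm 0).apply_zero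
    map_mem := fun {n a} _ hx => cAInfPos_le (S := C.Q₀.comap (evalMu m)) (hm 0).mem n a hx }⟩

theorem isCurvedFamily_map_caMu {C : Curv.{u}} (f : Curv.Hom cAInfCurv C) (N : ℕ) :
    IsCurvedFamily C.κ C.Q₀ (fun n => f.map (caMu n)) N where
  apply_zero := f.map_kappa
  mem _ hk := f.map_mem _ (caMu_mem_cAInfPos hk)
  defect_eq_zero q _ := by
    rw [← derivDefect_evalMu, ← hom_eq_evalMu f.toGrHom]
    exact sub_eq_zero.mpr (f.map_d _ _).symm

theorem curvHom_ext {C : Curv.{u}} (f g : Curv.Hom cAInfCurv C) : f = g := by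
  have hfg : f.toGrHom = g.toGrHom := by
    refine FreeOperad.hom_ext ?_
    rintro n _ ⟨_⟩
    exact (isCurvedFamily_map_caMu f n).apply_eq C.isCurved (isCurvedFamily_map_caMu g n) le_rfl
  exact Curv.Hom.ext (congrArg (fun F => @GrOperad.Hom.map _ _ F) hfg)

end CurvedOperad

/-- The quadruple `(cA∞, d, μ_0, ⟨μ_i⟩_{i>0})` is an object of `Curv`, and it is initial there. -/
theorem theorem1p2 :
    ∃ h : CurvedOperad.IsCurved CurvedOperad.cAInf.{u} (CurvedOperad.mu 0) CurvedOperad.cAInfPos,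
      Nonempty (CategoryTheory.Limits.IsInitial
        (⟨CurvedOperad.cAInf, CurvedOperad.mu 0, CurvedOperad.cAInfPos, h⟩ :
          CurvedOperad.Curv.{u})) :=
  ⟨CurvedOperad.cAInf_isCurved, ⟨CategoryTheory.Limits.IsInitial.ofUniqueHom
    (fun C => (CurvedOperad.exists_curvHom C).some) (fun _ _ => CurvedOperad.curvHom_ext _ _)⟩⟩
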